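/- Order the complex numbers lexicographically: $a+bi\preceq a'+b'i$ if $a=a'$ and $b\le b'$, or $a<a'$. Order the blocks of a block matrix $A=[A_{ij}]$, $1\le i\le l$, $1\le j\le r$, by $A_{ij}\le A_{i'j'}$ if $i=i'$ and $j\le j'$, or $i>i'$. A \emph{marked block matrix} is a complex block matrix together with a (possibly empty) set of marked square blocks. An \emph{admissible transformation} is $A\mapsto R^{-1}AS=[R_i^{-1}A_{ij}S_j]$, where $R=R_1\oplus\dots\oplus R_l$ and $S=S_1\oplus\dots\oplus S_r$ are unitary and $R_i=S_j$ whenever $A_{ij}$ is marked. Write $A\sim B$ ($A$ and $B$ are \emph{equivalent}) if $A$ and $B$ have the same division into blocks and the same disposition of marked blocks, and $B$ is obtained from $A$ by an admissible transformation. Call two strips \emph{linked} if their transforming blocks $R_i$, $S_j$ are identified through a chain of marked blocks. If some block of $A$ changes under admissible transformations, let $A_{pq}$ be the first such block. A \emph{derived matrix} $A'$ of $A$ is obtained as follows. Reduce $A$ by an admissible transformation to a matrix $\tilde A$ such that: (i) if the $p$-th horizontal and the $q$-th vertical strip are not linked, then $\tilde A_{pq}=a_1I\oplus\dots\oplus a_{k-1}I\oplus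 0$ with real $a_1>\dots>a_{k-1}>0$ (the zero summand may have no rows or no columns); (ii) if they are linked, then $\tilde A_{pq}=[F_{\alpha\beta}]_{\alpha,\beta=1}^k$ is block triangular, with $F_{\alpha\beta}=0$ for $\alpha>\beta$, $F_{\alpha\alpha}=\lambda_\alpha I$, $\lambda_1\succeq\dots\succeq\lambda_k$, and the columns of $F_{\alpha,\alpha+1}$ linearly independent whenever $\lambda_\alpha=\lambda_{\alpha+1}$. Then extend the partition of $\tilde A_{pq}$ into $k$ horizontal and $k$ vertical strips to the whole $p$-th horizontal and $q$-th vertical strips of $\tilde A$; successively, whenever new divisions pass through a marked block, make the perpendicular divisions that partition it into $k\times k$ subblocks with square diagonal subblocks; the diagonal subblocks become the marked ones. In case (i) mark additionally the subblocks $a_1I,\dots,a_{k-1}I$ of $\tilde A_{pq}$. A \emph{canonical form} $A^\infty$ of $A$ is obtained by forming a sequence $A,A',A'',\dots,A^{(s)}$, in which each matrix is a derived matrix of the preceding one and no block of $A^{(s)}$ changes under admissible transformations, and then removing from $A^{(s)}$ all additional divisions and marks. \textbf{Theorem.} For every marked block matrix $A$ the reduction process ends after finitely many steps, whatever choices are made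 in it. The canonical form $A^\infty$ exists, is uniquely determined by $A$ (it does not depend on the choices), and $A\sim A^\infty$. Moreover, for any two marked block matrices $A$ and $B$, $A\sim B$ if and only if $A^\infty=B^\infty$. -/

import Mathlib

/-- The lexicographic order on `ℂ`: `a + bi ⪯ a' + b'i` iff `a = a'` and `b ≤ b'`, or `a < a'`. -/
def lexLE (z w : ℂ) : Prop :=
  (z.re = w.re ∧ z.im ≤ w.im) ∨ z.re < w.re

section Strips

variable {m l : ℕ}

/-- The `i`-th strip of a division `f` of the index set `{0, …, m - 1}` into `l` strips;
`f` sends an index to the number of the strip it belongs to. -/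
def strip (f : Fin m → Fin l) (i : Fin l) : Finset (Fin m) :=
  Finset.univ.filter fun x => f x = i

/-- The size of the `i`-th strip (it may be `0`). -/
def stripSize (f : Fin m → Fin l) (i : Fin l) : ℕ := (strip f i).card

/-- The increasing enumeration of the `i`-th strip. -/
def stripEmb (f : Fin m → Fin l) (i : Fin l) : Fin (stripSize f i) ↪o Fin m :=
  (strip f i).orderEmbOfFin rfl

/-- The position (counted from `0`) of the index `x` inside its own strip. -/
def stripPos (f : Fin m → Fin l) (x : Fin m) : ℕ :=
  (Finset.univ.filter fun y => f y = f x ∧ y < x).card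

/-- Cut the `i`-th strip of `f` into `k + 1` consecutive substrips: the index at position `t` goes
to the substrip number `c i t`.  The substrip number `a` of the strip number `i` gets the number
`i * (k + 1) + a`, so the substrips are numbered in their natural order. -/
def cutLabel {k : ℕ} (f : Fin m → Fin l) (c : Fin l → ℕ → Fin (k + 1)) (x : Fin m) :
    Fin (l * (k + 1)) :=
  finProdFinEquiv (f x, c (f x) (stripPos f x))

theorem stripPos_lt {f : Fin m → Fin l} {x y : Fin m} (h : f x = f y) (hxy : x < y) :
    stripPos f x < stripPos f y := by
  apply Finset.card_lt_card
  rw [Finset.ssubset_iff_of_subset]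
  · exact ⟨x, by simp [h, hxy], by simp⟩
  · intro z hz
    simp only [Finset.mem_filter, Finset.mem_univ, true_and] at hz ⊢
    exact ⟨hz.1.trans h, hz.2.trans hxy⟩

theorem image_stripPos (f : Fin m → Fin l) (i : Fin l) :
    (strip f i).image (stripPos f) = Finset.range (stripSize f i) := by
  apply Finset.eq_of_subset_of_card_le
  · intro t ht
    obtain ⟨x, hx, rfl⟩ := Finset.mem_image.1 ht
    simp only [strip, Finset.mem_filter, Finset.mem_univ, true_and] at hx
    rw [Finset.mem_range]
    apply Finset.card_lt_card
    rw [Finset.ssubset_iff_of_subset]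
    · exact ⟨x, by simp [strip, hx], by simp⟩
    · intro z hz
      simp only [strip, Finset.mem_filter, Finset.mem_univ, true_and] at hz ⊢
      exact hz.1.trans hx
  · rw [Finset.card_range, Finset.card_image_of_injOn]
    · exact le_rfl
    · intro x hx y hy hxy
      simp only [strip, Finset.coe_filter, Finset.mem_univ, true_and, Set.mem_ofPred_eq] at hx hy
      rcases lt_trichotomy x y with h | h | h
      · exact absurd hxy (stripPos_lt (hx.trans hy.symm) h).ne
      · exact h
      · exact absurd hxy.symm (stripPos_lt (hy.trans hx.symm) h).ne

theorem stripSize_cutLabel {k : ℕ} (f : Fin m → Fin l) (c : Fin l → ℕ → Fin (k + 1))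
    (i : Fin l) (a : Fin (k + 1)) :
    stripSize (cutLabel f c) (finProdFinEquiv (i, a)) =
      ((Finset.range (stripSize f i)).filter fun t => c i t = a).card := by
  have h1 : strip (cutLabel f c) (finProdFinEquiv (i, a)) =
      (strip f i).filter fun x => c i (stripPos f x) = a := by
    ext x
    simp only [strip, cutLabel, Finset.mem_filter, Finset.mem_univ, true_and,
      EmbeddingLike.apply_eq_iff_eq, Prod.mk.injEq]
    constructor
    · rintro ⟨rfl, h⟩
      exact ⟨rfl, h⟩
    · rintro ⟨rfl, h⟩
      exact ⟨rfl, h⟩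
  rw [stripSize, h1, ← image_stripPos f i, Finset.filter_image, Finset.card_image_of_injOn]
  intro x hx y hy hxy
  simp only [strip, Finset.coe_filter, Finset.mem_filter, Finset.mem_univ, true_and,
    Set.mem_ofPred_eq] at hx hy
  rcases lt_trichotomy x y with h | h | h
  · exact absurd hxy (stripPos_lt (hx.1.trans hy.1.symm) h).ne
  · exact h
  · exact absurd hxy.symm (stripPos_lt (hy.1.trans hx.1.symm) h).ne

theorem cutLabel_monotone {k : ℕ} {f : Fin m → Fin l} (hf : Monotone f)
    {c : Fin l → ℕ → Fin (k + 1)} (hc : ∀ i, Monotone (c i)) : Monotone (cutLabel f c) := by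
  intro x y hxy
  rw [Fin.le_def]
  simp only [cutLabel, finProdFinEquiv_apply_val]
  rcases (hf hxy).lt_or_eq with h | h
  · have h1 : (f x : ℕ) + 1 ≤ f y := h
    have h2 := (c (f x) (stripPos f x)).isLt
    have h3 := Nat.mul_le_mul_left (k + 1) h1
    rw [Nat.mul_add] at h3
    omega
  · have h1 : stripPos f x ≤ stripPos f y := by
      rcases hxy.lt_or_eq with h' | h'
      · exact (stripPos_lt h h').le
      · rw [h']
    have h2 := hc (f y) h1
    rw [Fin.le_def] at h2
    rw [h]
    omega

end Strips

/-- A division of `m × n` matrices into `l` horizontal and `r` vertical strips, together with a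
set of marked square blocks.  The row `x` lies in the horizontal strip `row x`, the column `y` in
the vertical strip `col y`; monotonicity says that strips are consecutive.  Empty strips are
allowed. -/
structure Shape (m n : ℕ) where
  l : ℕ
  r : ℕ
  row : Fin m → Fin l
  col : Fin n → Fin r
  row_mono : Monotone row
  col_mono : Monotone col
  marked : Set (Fin l × Fin r)
  square : ∀ i j, (i, j) ∈ marked → stripSize row i = stripSize col j

namespace Shape

variable {m n : ℕ} (D : Shape m n)

/-- The block `A_{ij}`. -/
def block (A : Matrix (Fin m) (Fin n) ℂ) (i : Fin D.l) (j : Fin D.r) :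
    Matrix (Fin (stripSize D.row i)) (Fin (stripSize D.col j)) ℂ :=
  A.submatrix (stripEmb D.row i) (stripEmb D.col j)

/-- The diagonal block `R_i` of an `m × m` matrix `R`. -/
def rowBlock (R : Matrix (Fin m) (Fin m) ℂ) (i : Fin D.l) :
    Matrix (Fin (stripSize D.row i)) (Fin (stripSize D.row i)) ℂ :=
  R.submatrix (stripEmb D.row i) (stripEmb D.row i)

/-- The diagonal block `S_j` of an `n × n` matrix `S`. -/
def colBlock (S : Matrix (Fin n) (Fin n) ℂ) (j : Fin D.r) :
    Matrix (Fin (stripSize D.col j)) (Fin (stripSize D.col j)) ℂ :=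
  S.submatrix (stripEmb D.col j) (stripEmb D.col j)

/-- The pair `(R, S)` of unitary matrices defines an admissible transformation `A ↦ R⁻¹ A S`:
`R = R_1 ⊕ ⋯ ⊕ R_l` and `S = S_1 ⊕ ⋯ ⊕ S_r` are block diagonal with respect to the strips, and
`R_i = S_j` whenever the block with indices `(i, j)` is marked. -/
structure IsAdmissible (R : Matrix.unitaryGroup (Fin m) ℂ) (S : Matrix.unitaryGroup (Fin n) ℂ) :
    Prop where
  row_diag : ∀ x x', D.row x ≠ D.row x' → (R : Matrix (Fin m) (Fin m) ℂ) x x' = 0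
  col_diag : ∀ y y', D.col y ≠ D.col y' → (S : Matrix (Fin n) (Fin n) ℂ) y y' = 0
  marked_eq : ∀ i j (h : (i, j) ∈ D.marked),
    D.rowBlock R i =
      (D.colBlock S j).submatrix (Fin.cast (D.square i j h)) (Fin.cast (D.square i j h))

/-- Strips (horizontal ones `Sum.inl i`, vertical ones `Sum.inr j`) whose diagonal blocks in
admissible transformations are identified, directly or through a chain of marked blocks. -/
def Linked : Fin D.l ⊕ Fin D.r → Fin D.l ⊕ Fin D.r → Prop :=
  Relation.EqvGen fun s t => ∃ i j, (i, j) ∈ D.marked ∧ s = Sum.inl i ∧ t = Sum.inr j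

open Classical in
/-- The cutting function of the strip `s` when the `p`-th horizontal and the `q`-th vertical strips
are cut according to `c`: every strip linked to one of these two is cut in the same way, and the
other strips are left whole (all their positions lie in the substrip number `0`). -/
noncomputable def cutting {k : ℕ} (p : Fin D.l) (q : Fin D.r) (c : ℕ → Fin (k + 1))
    (s : Fin D.l ⊕ Fin D.r) : ℕ → Fin (k + 1) :=
  if D.Linked s (Sum.inl p) ∨ D.Linked s (Sum.inr q) then c else fun _ => 0

theorem cutting_monotone {k : ℕ} (p : Fin D.l) (q : Fin D.r) {c : ℕ → Fin (k + 1)}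
    (hc : Monotone c) (s : Fin D.l ⊕ Fin D.r) : Monotone (D.cutting p q c s) := by
  unfold cutting
  split_ifs
  · exact hc
  · exact monotone_const

theorem cutting_eq_of_marked {k : ℕ} (p : Fin D.l) (q : Fin D.r) (c : ℕ → Fin (k + 1))
    {i : Fin D.l} {j : Fin D.r} (h : (i, j) ∈ D.marked) :
    D.cutting p q c (Sum.inl i) = D.cutting p q c (Sum.inr j) := by
  have h1 : D.Linked (Sum.inl i) (Sum.inr j) := .rel _ _ ⟨i, j, h, rfl, rfl⟩
  have h2 : ∀ t, D.Linked (Sum.inl i) t ↔ D.Linked (Sum.inr j) t := fun t =>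
    ⟨fun h => (h1.symm).trans _ _ _ h, fun h => h1.trans _ _ _ h⟩
  unfold cutting
  split_ifs with h3 h4 h4
  · rfl
  · exact absurd (h3.imp (h2 _).1 (h2 _).1) h4
  · exact absurd (h4.imp (h2 _).2 (h2 _).2) h3
  · rfl

/-- The division obtained by cutting the `p`-th horizontal strip and the `q`-th vertical strip
according to `c`, and extending the new divisions through all marked blocks.  Each marked block
that is cut is partitioned into `(k + 1) × (k + 1)` subblocks and its diagonal subblocks become
the marked ones.  A strip that is not cut is followed by `k` empty strips, which contain no
entries. -/
noncomputable def refine {k : ℕ} (p : Fin D.l) (q : Fin D.r) (c : ℕ → Fin (k + 1))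
    (hc : Monotone c) : Shape m n where
  l := D.l * (k + 1)
  r := D.r * (k + 1)
  row := cutLabel D.row fun i => D.cutting p q c (Sum.inl i)
  col := cutLabel D.col fun j => D.cutting p q c (Sum.inr j)
  row_mono := cutLabel_monotone D.row_mono fun _ => D.cutting_monotone p q hc _
  col_mono := cutLabel_monotone D.col_mono fun _ => D.cutting_monotone p q hc _
  marked := {b | ∃ i j a, (i, j) ∈ D.marked ∧
    b = (finProdFinEquiv (i, a), finProdFinEquiv (j, a))}
  square := by
    rintro _ _ ⟨i, j, a, h, hb⟩
    obtain ⟨rfl, rfl⟩ := Prod.mk.inj hb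
    rw [stripSize_cutLabel, stripSize_cutLabel, D.square i j h, D.cutting_eq_of_marked p q c h]

/-- The same division, in which additionally the first `k` diagonal subblocks of the block with
indices `(p, q)` are marked. -/
noncomputable def refineMark {k : ℕ} (p : Fin D.l) (q : Fin D.r) (c : ℕ → Fin (k + 1))
    (hc : Monotone c)
    (hcpq : ∀ t, c t ≠ Fin.last k → t < stripSize D.row p ∧ t < stripSize D.col q) :
    Shape m n where
  l := D.l * (k + 1)
  r := D.r * (k + 1)
  row := (D.refine p q c hc).row
  col := (D.refine p q c hc).col
  row_mono := (D.refine p q c hc).row_mono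
  col_mono := (D.refine p q c hc).col_mono
  marked := (D.refine p q c hc).marked ∪
    {b | ∃ a, a ≠ Fin.last k ∧ b = (finProdFinEquiv (p, a), finProdFinEquiv (q, a))}
  square := by
    rintro i' j' (h | ⟨a, ha, hb⟩)
    · exact (D.refine p q c hc).square i' j' h
    · obtain ⟨rfl, rfl⟩ := Prod.mk.inj hb
      have hp : D.cutting p q c (Sum.inl p) = c := by
        unfold cutting
        exact if_pos (Or.inl (.refl _))
      have hq : D.cutting p q c (Sum.inr q) = c := by
        unfold cutting
        exact if_pos (Or.inr (.refl _))
      simp only [refine]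
      rw [stripSize_cutLabel, stripSize_cutLabel, hp, hq]
      congr 1
      ext t
      simp only [Finset.mem_filter, Finset.mem_range]
      constructor
      · rintro ⟨-, h⟩
        exact ⟨(hcpq t (h ▸ ha)).2, h⟩
      · rintro ⟨-, h⟩
        exact ⟨(hcpq t (h ▸ ha)).1, h⟩

end Shape

/-- The `s × t` matrix `F` equals `a_1 I ⊕ ⋯ ⊕ a_k I ⊕ 0` with real `a_1 > ⋯ > a_k > 0`; the row and
the column at position `x` lie in the horizontal and the vertical strip number `c x`.  The value
`a (Fin.last k) = 0` belongs to the last summand, the zero matrix, which may have no rows or no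
columns; each of the other summands is a nonempty square matrix. -/
structure IsDiagonalForm {s t k : ℕ} (F : Matrix (Fin s) (Fin t) ℂ) (c : ℕ → Fin (k + 1))
    (a : Fin (k + 1) → ℝ) : Prop where
  mono : Monotone c
  strictAnti : StrictAnti a
  last_eq : a (Fin.last k) = 0
  nonempty : ∀ i, i ≠ Fin.last k → ∃ x, c x = i
  lt_size : ∀ x, c x ≠ Fin.last k → x < s ∧ x < t
  entry : ∀ (x : Fin s) (y : Fin t), F x y = if (x : ℕ) = (y : ℕ) then (a (c x) : ℂ) else 0

/-- The square matrix `F` is block triangular, with `k + 1` nonempty horizontal strips and the same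
vertical strips (the row and the column at position `x` lie in the strips number `c x`), diagonal
blocks `λ_1 I, …, λ_{k+1} I` such that `λ_1 ⪰ ⋯ ⪰ λ_{k+1}`, zero blocks below them, and such that
the columns of the block `F_{i,i+1}` are linearly independent if `λ_i = λ_{i+1}`. -/
structure IsTriangularForm {s k : ℕ} (F : Matrix (Fin s) (Fin s) ℂ) (c : ℕ → Fin (k + 1))
    (lam : Fin (k + 1) → ℂ) : Prop where
  mono : Monotone c
  nonempty : ∀ i, ∃ x : Fin s, c x = i
  anti : ∀ i j, i ≤ j → lexLE (lam j) (lam i)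
  lower : ∀ x y : Fin s, c y < c x → F x y = 0
  diag : ∀ x y : Fin s, c x = c y → F x y = if x = y then lam (c x) else 0
  indep : ∀ i : Fin k, lam i.castSucc = lam i.succ →
    LinearIndependent ℂ fun (y : {y : Fin s // c y = i.succ})
      (x : {x : Fin s // c x = i.castSucc}) => F x y

/-- A marked block matrix of size `m × n`. -/
structure MarkedBlockMatrix (m n : ℕ) where
  shape : Shape m n
  mat : Matrix (Fin m) (Fin n) ℂ

namespace MarkedBlockMatrix

variable {m n : ℕ}

/-- Equivalence of marked block matrices: they have the same division into blocks and the same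
marked blocks, and one is carried to the other by an admissible transformation. -/
def Equivalent (A B : MarkedBlockMatrix m n) : Prop :=
  B.shape = A.shape ∧ ∃ R S, A.shape.IsAdmissible R S ∧
    B.mat = ((R⁻¹ : Matrix.unitaryGroup (Fin m) ℂ) : Matrix (Fin m) (Fin m) ℂ) * A.mat *
      (S : Matrix (Fin n) (Fin n) ℂ)

/-- The block with indices `(i, j)` changes under admissible transformations. -/
def Changes (A : MarkedBlockMatrix m n) (i : Fin A.shape.l) (j : Fin A.shape.r) : Prop :=
  ∃ R S, A.shape.IsAdmissible R S ∧
    A.shape.block (((R⁻¹ : Matrix.unitaryGroup (Fin m) ℂ) : Matrix (Fin m) (Fin m) ℂ) * A.mat *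
      (S : Matrix (Fin n) (Fin n) ℂ)) i j ≠ A.shape.block A.mat i j

/-- The block with indices `(p, q)` is the first one that changes under admissible transformations,
in the ordering `A_{ij} ≤ A_{i'j'}` iff `i = i'` and `j ≤ j'`, or `i > i'`. -/
def IsFirstChanging (A : MarkedBlockMatrix m n) (p : Fin A.shape.l) (q : Fin A.shape.r) : Prop :=
  A.Changes p q ∧ ∀ i j, A.Changes i j → (p = i ∧ q ≤ j) ∨ p > i

/-- `A'` is a derived matrix of `A`.  The first changing block, with indices `(p, q)`, is
transformed by unitary similarity if its two strips are linked and by unitary equivalence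
otherwise.  The matrix is reduced by an admissible transformation to one whose block with indices
`(p, q)` is triangular (respectively diagonal), and then the division and the marking are refined;
in the second case the subblocks `a_1 I, …, a_k I` are additionally marked. -/
def Derived (A A' : MarkedBlockMatrix m n) : Prop :=
  ∃ p q, A.IsFirstChanging p q ∧ A.Equivalent ⟨A.shape, A'.mat⟩ ∧
    ((A.shape.Linked (Sum.inl p) (Sum.inr q) ∧
        ∃ (h : stripSize A.shape.row p = stripSize A.shape.col q) (k : ℕ)
          (c : ℕ → Fin (k + 1)) (lam : Fin (k + 1) → ℂ)
          (hF : IsTriangularForm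
            ((A.shape.block A'.mat p q).submatrix id (Fin.cast h)) c lam),
          A'.shape = A.shape.refine p q c hF.mono) ∨
      (¬ A.shape.Linked (Sum.inl p) (Sum.inr q) ∧
        ∃ (k : ℕ) (c : ℕ → Fin (k + 1)) (a : Fin (k + 1) → ℝ)
          (hF : IsDiagonalForm (A.shape.block A'.mat p q) c a),
          A'.shape = A.shape.refineMark p q c hF.mono hF.lt_size))

/-- Admissible transformations do not change any block of `A`. -/
def IsFinal (A : MarkedBlockMatrix m n) : Prop :=
  ∀ i j, ¬ A.Changes i j

/-- `C` is a canonical form `A^∞` of `A`: some sequence `A, A', A'', …, A^(s)`, in which each matrix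
is a derived matrix of the previous one, ends with a matrix that admissible transformations do not
change, and `C` is `A^(s)` with all additional divisions and marks removed. -/
def IsCanonicalForm (A C : MarkedBlockMatrix m n) : Prop :=
  ∃ T, Relation.ReflTransGen Derived A T ∧ T.IsFinal ∧ C = ⟨A.shape, T.mat⟩

end MarkedBlockMatrix

/-!
Admissible transformations form a group acting on matrices, so everything reduces to one step of the
reduction: derived matrices `A'`, `B'` of equivalent matrices `A`, `B` must have the same division
and be equivalent for it (`MarkedBlockMatrix.Derived.equivalent`).  Equivalent matrices have the
same first changing block, and the transformation between `A'` and `B'` acts on that block by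
unitary similarity or by unitary equivalence, carrying one reduced form to another.

* Two unitarily similar triangular forms have the same strips and the same diagonal, and the
  similarity is block diagonal (`IsTriangularForm.unique`).  Indeed, the flag `0 = V_0 < V_1 < ⋯`
  spanned by the first strips is intrinsic: `λ_{i+1}` is the greatest eigenvalue of the operator on
  the quotient by `V_i`, and `V_{i+1}` is the preimage of `V_i` under `F - λ_{i+1}`.  The triangular
  form itself is *not* unique, only its shape is.
* Two unitarily equivalent diagonal forms coincide, and the transformation is block diagonal with
  equal blocks at the nonzero values, because it commutes with the Gram matrices
  (`IsDiagonalForm.unique`).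

These conclusions say precisely that the transformation is admissible for the refined division
(`Shape.mem_blockSpace_refine`, `Shape.mem_blockSpace_refineMark`).

A derived matrix exists as long as some block changes: the diagonal form is the singular value
decomposition (`exists_isDiagonalForm`), the triangular form comes from splitting off the eigenspace
of the greatest eigenvalue repeatedly (`exists_isTriangularForm`), and unitary matrices prescribed
on the two strips extend to an admissible transformation (`Shape.exists_isAdmissible`).

The process ends because the dimension of the space of all, not necessarily unitary, pairs
`(R, S)` with the required block structure drops at each step
(`MarkedBlockMatrix.Derived.blockSpace_lt`).  When it ends nothing moves the matrix any more, so
equivalent final matrices are equal.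
-/

/-! ### Uniqueness of the triangular and the diagonal forms -/

section Uniqueness

open Matrix

theorem lexLE_antisymm {z w : ℂ} (h : lexLE z w) (h' : lexLE w z) : z = w := by
  rcases h with ⟨h, h1⟩ | h <;> rcases h' with ⟨h', h1'⟩ | h'
  · exact Complex.ext h (le_antisymm h1 h1')
  · exact absurd h.symm h'.ne
  · exact absurd h'.symm h.ne
  · exact absurd h' h.asymm

/-- A unitary (or just left invertible) matrix that carries the vectors supported in an initial
segment `P` to vectors supported in an initial segment `Q` forces `P ⊆ Q`: compare dimensions. -/
theorem imp_of_mapsTo_support {s : ℕ} {U V : Matrix (Fin s) (Fin s) ℂ} (hVU : V * U = 1)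
    {P Q : ℕ → Prop} (hP : ∀ x y, x ≤ y → P y → P x) (hQ : ∀ x y, x ≤ y → Q y → Q x)
    (h : ∀ v : Fin s → ℂ, (∀ x : Fin s, ¬ P x → v x = 0) →
      ∀ x : Fin s, ¬ Q x → (U *ᵥ v) x = 0) :
    ∀ x, x < s → P x → Q x := by
  classical
  intro x hx hPx
  by_contra hQx
  let e : ({x : Fin s // P x} → ℂ) →ₗ[ℂ] (Fin s → ℂ) :=
    Function.ExtendByZero.linearMap ℂ Subtype.val
  have he : ∀ w (y : Fin s) (hy : P y), e w y = w ⟨y, hy⟩ := fun w y hy =>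
    Subtype.val_injective.extend_apply w 0 (⟨y, hy⟩ : {x : Fin s // P x})
  have he' : ∀ w (y : Fin s), ¬ P y → e w y = 0 := fun w y hy =>
    Function.extend_apply' _ _ _ (by rintro ⟨z, rfl⟩; exact hy z.2)
  let f : ({x : Fin s // P x} → ℂ) →ₗ[ℂ] ({x : Fin s // Q x} → ℂ) :=
    (LinearMap.funLeft ℂ ℂ Subtype.val).comp ((Matrix.mulVecLin U).comp e)
  have hf : Function.Injective f := by
    rw [← LinearMap.ker_eq_bot, LinearMap.ker_eq_bot']
    intro w hw
    have h0 : U *ᵥ e w = 0 := by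
      ext y
      by_cases hy : Q y
      · exact congrFun hw ⟨y, hy⟩
      · exact h _ (he' w) y hy
    have h1 : e w = 0 := by
      rw [← Matrix.one_mulVec (e w), ← hVU, ← Matrix.mulVec_mulVec, h0, Matrix.mulVec_zero]
    ext ⟨y, hy⟩
    rw [← he w y hy, h1]
    rfl
  have hle := LinearMap.finrank_le_finrank_of_injective hf
  simp only [Module.finrank_fintype_fun_eq_card, Fintype.card_subtype] at hle
  refine absurd hle (not_le.2 (Finset.card_lt_card ?_))
  rw [Finset.ssubset_iff_of_subset]
  · exact ⟨⟨x, hx⟩, by simpa using hPx, by simpa using hQx⟩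
  · intro y hy
    simp only [Finset.mem_filter, Finset.mem_univ, true_and] at hy ⊢
    rcases le_total (y : ℕ) x with h' | h'
    · exact hP _ _ h' hPx
    · exact absurd (hQ _ _ h' hy) hQx

/-- The vectors supported in the strips with numbers less than `α`. -/
def InFlag {s k : ℕ} (c : ℕ → Fin (k + 1)) (α : ℕ) (v : Fin s → ℂ) : Prop :=
  ∀ x : Fin s, α ≤ (c x : ℕ) → v x = 0

namespace IsTriangularForm

variable {s k k' : ℕ} {F F' : Matrix (Fin s) (Fin s) ℂ} {c : ℕ → Fin (k + 1)}
  {c' : ℕ → Fin (k' + 1)} {lam : Fin (k + 1) → ℂ} {lam' : Fin (k' + 1) → ℂ}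

theorem mulVec_apply_of_top (hF : IsTriangularForm F c lam) {v : Fin s → ℂ} {x : Fin s}
    (hx : ∀ y : Fin s, c x < c y → v y = 0) : (F *ᵥ v) x = lam (c x) * v x := by
  rw [Matrix.mulVec, dotProduct, Finset.sum_eq_single x]
  · rw [hF.diag x x rfl, if_pos rfl]
  · intro y _ hy
    rcases lt_trichotomy (c y) (c x) with h | h | h
    · rw [hF.lower x y h, zero_mul]
    · rw [hF.diag x y h.symm, if_neg (Ne.symm hy), zero_mul]
    · rw [hx y h, mul_zero]
  · simp

theorem exists_top {α : ℕ} {v : Fin s → ℂ} (hv : ¬ InFlag c α v) :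
    ∃ x : Fin s, α ≤ (c x : ℕ) ∧ v x ≠ 0 ∧ ∀ y : Fin s, c x < c y → v y = 0 := by
  classical
  unfold InFlag at hv
  push Not at hv
  obtain ⟨x₀, h₀, h₀'⟩ := hv
  obtain ⟨x, hx, hmax⟩ := Finset.exists_max_image (Finset.univ.filter fun x => v x ≠ 0)
    (fun x => c x) ⟨x₀, by simpa using h₀'⟩
  simp only [Finset.mem_filter, Finset.mem_univ, true_and] at hx hmax
  refine ⟨x, h₀.trans (hmax x₀ h₀'), hx, fun y hy => ?_⟩
  by_contra h
  exact absurd (hmax y h) (not_le.2 hy)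

theorem exists_eq_lam (hF : IsTriangularForm F c lam) {α : ℕ} {v : Fin s → ℂ} {μ : ℂ}
    (hv : ¬ InFlag c α v) (h : InFlag c α (F *ᵥ v - μ • v)) :
    ∃ β : Fin (k + 1), α ≤ (β : ℕ) ∧ μ = lam β := by
  obtain ⟨x, hx, hvx, htop⟩ := exists_top hv
  refine ⟨c x, hx, ?_⟩
  have h1 := h x hx
  rw [Pi.sub_apply, hF.mulVec_apply_of_top htop, Pi.smul_apply, smul_eq_mul, ← sub_mul] at h1
  exact (sub_eq_zero.1 ((mul_eq_zero.1 h1).resolve_right hvx)).symm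

/-- The flag is determined by `F` and the diagonal: its next term is the preimage of the previous
one under `F - λ_α`. -/
theorem inFlag_succ_iff (hF : IsTriangularForm F c lam) {α : ℕ} (hα : α < k + 1) (v : Fin s → ℂ) :
    InFlag c (α + 1) v ↔ InFlag c α (F *ᵥ v - lam ⟨α, hα⟩ • v) := by
  constructor
  · intro h x hx
    have htop : ∀ y : Fin s, c x < c y → v y = 0 := fun y hy =>
      h y (Nat.succ_le_of_lt (hx.trans_lt hy))
    rw [Pi.sub_apply, hF.mulVec_apply_of_top htop, Pi.smul_apply, smul_eq_mul, ← sub_mul]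
    rcases hx.eq_or_lt with h' | h'
    · have : c x = ⟨α, hα⟩ := Fin.ext h'.symm
      rw [this, sub_self, zero_mul]
    · rw [h x h', mul_zero]
  · intro h
    by_contra hv
    obtain ⟨x, hx, hvx, htop⟩ := exists_top hv
    have hlam : lam (c x) = lam ⟨α, hα⟩ := by
      have h1 := h x (by omega)
      rw [Pi.sub_apply, hF.mulVec_apply_of_top htop, Pi.smul_apply, smul_eq_mul, ← sub_mul] at h1
      exact sub_eq_zero.1 ((mul_eq_zero.1 h1).resolve_right hvx)
    -- The strip `i` just before the one of `x` has the same diagonal value by monotonicity.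
    obtain ⟨i, hi⟩ : ∃ i : Fin k, i.succ = c x :=
      Fin.exists_succ_eq.2 (fun h0 => by rw [h0] at hx; simp at hx)
    have hiv : (i : ℕ) + 1 = (c x : ℕ) := by rw [← hi]; simp
    have hi1 : lam i.castSucc = lam ⟨α, hα⟩ := by
      apply lexLE_antisymm
      · exact hF.anti _ _ (by rw [Fin.le_def]; simp; omega)
      · rw [← hlam]
        exact hF.anti _ _ (by rw [Fin.le_def]; simp; omega)
    have hli := Fintype.linearIndependent_iff.1 (hF.indep i (by rw [hi, hi1, hlam]))
    refine hvx (hli (fun y => v y) ?_ ⟨x, hi.symm⟩)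
    ext ⟨x', hx'⟩
    have hx'v : (c x' : ℕ) = i := by rw [hx']; simp
    have h1 := h x' (by omega)
    rw [Pi.sub_apply, Pi.smul_apply, smul_eq_mul, sub_eq_zero, Matrix.mulVec, dotProduct,
      ← Finset.sum_filter_add_sum_filter_not _ (fun y : Fin s => c y = i.succ)] at h1
    rw [Finset.sum_subtype (p := fun y : Fin s => c y = i.succ) _ (by simp)
      (fun y => F x' y * v y), Finset.sum_eq_single (M := ℂ) x'] at h1
    · rw [hF.diag x' x' rfl, if_pos rfl, hx', hi1, add_eq_right] at h1
      rw [Finset.sum_apply]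
      refine Eq.trans ?_ h1
      exact Finset.sum_congr rfl fun y _ => mul_comm _ _
    · intro y hy hyx
      rcases lt_trichotomy (c y) (c x') with h' | h' | h'
      · rw [hF.lower x' y h', zero_mul]
      · rw [hF.diag x' y h'.symm, if_neg (Ne.symm hyx), zero_mul]
      · rw [htop y, mul_zero]
        simp only [Finset.mem_filter, Finset.mem_univ, true_and] at hy
        rw [Fin.lt_def] at h' ⊢
        have : (c y : ℕ) ≠ i.succ := fun h => hy (Fin.ext h)
        rw [Fin.val_succ] at this
        omega
    · intro hx''
      exfalso
      apply hx''
      simp [hx', Fin.ext_iff]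

theorem lam_le_of_inFlag_iff (hF : IsTriangularForm F c lam) (hF' : IsTriangularForm F' c' lam')
    {U V : Matrix (Fin s) (Fin s) ℂ} (hUV : U * V = 1) (h : F * U = U * F') {α : ℕ}
    (hα : α < k + 1) (hflag : ∀ v, InFlag c' α v ↔ InFlag c α (U *ᵥ v)) :
    ∃ hα' : α < k' + 1, lexLE (lam ⟨α, hα⟩) (lam' ⟨α, hα'⟩) := by
  obtain ⟨x, hx⟩ := hF.nonempty ⟨α, hα⟩
  set v : Fin s → ℂ := Pi.single x 1
  have hv1 : InFlag c (α + 1) v := fun y hy => Pi.single_eq_of_ne (by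
    rintro rfl
    rw [hx] at hy
    simp at hy) _
  have hv0 : ¬ InFlag c α v := fun h0 => by
    have := h0 x (by simp [hx])
    simp [v] at this
  have hUVv : U *ᵥ (V *ᵥ v) = v := by rw [Matrix.mulVec_mulVec, hUV, Matrix.one_mulVec]
  rw [hF.inFlag_succ_iff hα, ← hUVv, Matrix.mulVec_mulVec, h, ← Matrix.mulVec_mulVec,
    ← Matrix.mulVec_smul, ← Matrix.mulVec_sub, ← hflag] at hv1
  rw [← hUVv, ← hflag] at hv0
  obtain ⟨β, hβ, hβ'⟩ := hF'.exists_eq_lam hv0 hv1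
  refine ⟨hβ.trans_lt β.2, ?_⟩
  rw [hβ']
  exact hF'.anti _ _ hβ

theorem inFlag_iff (hF : IsTriangularForm F c lam) (hF' : IsTriangularForm F' c' lam')
    {U V : Matrix (Fin s) (Fin s) ℂ} (hUV : U * V = 1) (hVU : V * U = 1) (h : F * U = U * F')
    (α : ℕ) (hα : α ≤ k + 1) : ∀ v, InFlag c' α v ↔ InFlag c α (U *ᵥ v) := by
  have hVUv : ∀ v, V *ᵥ (U *ᵥ v) = v := fun v => by
    rw [Matrix.mulVec_mulVec, hVU, Matrix.one_mulVec]
  have hUVv : ∀ v, U *ᵥ (V *ᵥ v) = v := fun v => by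
    rw [Matrix.mulVec_mulVec, hUV, Matrix.one_mulVec]
  induction α with
  | zero =>
    intro v
    constructor
    · intro hv
      have : v = 0 := funext fun x => hv x (Nat.zero_le _)
      rw [this, Matrix.mulVec_zero]
      exact fun _ _ => rfl
    · intro hv
      have : U *ᵥ v = 0 := funext fun x => hv x (Nat.zero_le _)
      rw [← hVUv v, this, Matrix.mulVec_zero]
      exact fun _ _ => rfl
  | succ α ih =>
    intro v
    have ih' := ih (by omega)
    obtain ⟨hα', h1⟩ := hF.lam_le_of_inFlag_iff hF' hUV h hα ih'
    have h' : F' * V = V * F := by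
      rw [← Matrix.one_mul (F' * V), ← hVU, Matrix.mul_assoc, ← Matrix.mul_assoc U F', ← h,
        Matrix.mul_assoc, hUV, Matrix.mul_one]
    obtain ⟨_, h2⟩ := hF'.lam_le_of_inFlag_iff hF hVU h' hα'
      (fun w => by rw [ih' (V *ᵥ w), hUVv])
    rw [hF'.inFlag_succ_iff hα', hF.inFlag_succ_iff hα, ih', ← lexLE_antisymm h1 h2,
      Matrix.mulVec_sub, Matrix.mulVec_smul, Matrix.mulVec_mulVec, ← h, ← Matrix.mulVec_mulVec]

/-- Two triangular forms that are unitarily similar have the same strips and the same diagonal,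
and every unitary similarity between them is block diagonal. -/
theorem unique (hF : IsTriangularForm F c lam) (hF' : IsTriangularForm F' c' lam')
    {U : Matrix (Fin s) (Fin s) ℂ} (hU : U ∈ unitaryGroup (Fin s) ℂ) (h : F * U = U * F') :
    k = k' ∧ HEq c c' ∧ HEq lam lam' ∧ ∀ x y : Fin s, c x ≠ c y → U x y = 0 := by
  have hUV : U * star U = 1 := mem_unitaryGroup_iff.1 hU
  have hVU : star U * U = 1 := mem_unitaryGroup_iff'.1 hU
  have h' : F' * star U = star U * F := by
    rw [← Matrix.one_mul (F' * star U), ← hVU, Matrix.mul_assoc, ← Matrix.mul_assoc U F', ← h,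
      Matrix.mul_assoc, hUV, Matrix.mul_one]
  have hfl := hF.inFlag_iff hF' hUV hVU h
  have hfl' := hF'.inFlag_iff hF hVU hUV h'
  have hk : k ≤ k' := by
    obtain ⟨hk, -⟩ := hF.lam_le_of_inFlag_iff hF' hUV h (lt_add_one k) (hfl k (by omega))
    omega
  have hk' : k' ≤ k := by
    obtain ⟨hk, -⟩ := hF'.lam_le_of_inFlag_iff hF hVU h' (lt_add_one k') (hfl' k' (by omega))
    omega
  obtain rfl := le_antisymm hk hk'
  have hlam : lam = lam' := by
    ext1 α
    obtain ⟨_, h1⟩ := hF.lam_le_of_inFlag_iff hF' hUV h α.2 (hfl α α.2.le)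
    obtain ⟨_, h2⟩ := hF'.lam_le_of_inFlag_iff hF hVU h' α.2 (hfl' α α.2.le)
    exact lexLE_antisymm h1 h2
  have key : ∀ {c c' : ℕ → Fin (k + 1)} {U V : Matrix (Fin s) (Fin s) ℂ}, V * U = 1 →
      Monotone c → Monotone c' →
      (∀ α ≤ k + 1, ∀ v, InFlag c' α v ↔ InFlag c α (U *ᵥ v)) →
      ∀ x < s, c x ≤ c' x := by
    intro c c' U V hVU hc hc' hfl x hx
    rw [Fin.le_def]
    by_contra hlt
    have h1 := imp_of_mapsTo_support hVU (P := fun y => (c' y : ℕ) < c' x + 1)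
      (Q := fun y => (c y : ℕ) < c' x + 1)
      (fun y z hyz hz => lt_of_le_of_lt (Fin.le_def.1 (hc' hyz)) hz)
      (fun y z hyz hz => lt_of_le_of_lt (Fin.le_def.1 (hc hyz)) hz)
      (fun v hv y hy => (hfl _ (by omega) v).1 (fun z hz => hv z (not_lt.2 hz)) y (not_lt.1 hy))
      x hx (Nat.lt_succ_self _)
    omega
  -- Beyond the positions `0, …, s - 1` both cutting functions take their greatest value.
  have hlast : ∀ {c : ℕ → Fin (k + 1)}, Monotone c → (∀ i, ∃ x : Fin s, c x = i) →
      ∀ x, s ≤ x → c x = Fin.last k := by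
    intro c hc hne x hx
    obtain ⟨y, hy⟩ := hne (Fin.last k)
    exact le_antisymm (Fin.le_last _) (hy ▸ hc (y.2.le.trans hx))
  have hc : c = c' := by
    ext1 x
    rcases lt_or_ge x s with hx | hx
    · exact le_antisymm (key hVU hF.mono hF'.mono hfl x hx)
        (key hUV hF'.mono hF.mono hfl' x hx)
    · rw [hlast hF.mono hF.nonempty x hx, hlast hF'.mono hF'.nonempty x hx]
  subst hc hlam
  -- Both `U` and its inverse, the conjugate transpose, are block upper triangular.
  have hlow : ∀ {U : Matrix (Fin s) (Fin s) ℂ},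
      (∀ α ≤ k + 1, ∀ v, InFlag c α v ↔ InFlag c α (U *ᵥ v)) →
      ∀ x y : Fin s, c y < c x → U x y = 0 := by
    intro U hfl x y hxy
    have h1 : InFlag c ((c y : ℕ) + 1) (Pi.single y 1 : Fin s → ℂ) := fun z hz =>
      Pi.single_eq_of_ne (by rintro rfl; omega) _
    have h2 := (hfl _ (by omega) _).1 h1 x hxy
    rwa [Matrix.mulVec_single_one] at h2
  refine ⟨rfl, HEq.rfl, HEq.rfl, fun x y hxy => ?_⟩
  rcases lt_or_gt_of_ne hxy with h1 | h1
  · have := hlow hfl' y x h1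
    rwa [star_apply, star_eq_zero] at this
  · exact hlow hfl x y h1

end IsTriangularForm

end Uniqueness

section DiagonalUniqueness

open Matrix

namespace IsDiagonalForm

variable {s t k k' : ℕ} {F F' : Matrix (Fin s) (Fin t) ℂ} {c : ℕ → Fin (k + 1)}
  {c' : ℕ → Fin (k' + 1)} {a : Fin (k + 1) → ℝ} {a' : Fin (k' + 1) → ℝ}

theorem nonneg (hF : IsDiagonalForm F c a) (i : Fin (k + 1)) : 0 ≤ a i := by
  rw [← hF.last_eq]
  exact hF.strictAnti.antitone (Fin.le_last i)

theorem eq_last (hF : IsDiagonalForm F c a) {x : ℕ} (hx : s ≤ x ∨ t ≤ x) : c x = Fin.last k := by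
  by_contra h
  have := hF.lt_size x h
  omega

theorem eq_zero (hF : IsDiagonalForm F c a) {x : ℕ} (hx : s ≤ x ∨ t ≤ x) : a (c x) = 0 := by
  rw [hF.eq_last hx, hF.last_eq]

theorem pos (hF : IsDiagonalForm F c a) {i : Fin (k + 1)} (hi : i ≠ Fin.last k) : 0 < a i := by
  rw [← hF.last_eq]
  exact hF.strictAnti (Fin.lt_last_iff_ne_last.2 hi)

protected theorem conjTranspose (hF : IsDiagonalForm F c a) : IsDiagonalForm Fᴴ c a where
  mono := hF.mono
  strictAnti := hF.strictAnti
  last_eq := hF.last_eq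
  nonempty := hF.nonempty
  lt_size x hx := (hF.lt_size x hx).symm
  entry x y := by
    rw [conjTranspose_apply, hF.entry]
    by_cases h : (x : ℕ) = y
    · rw [if_pos h, if_pos h.symm, h]
      simp
    · rw [if_neg h, if_neg (Ne.symm h), star_zero]

theorem mul_apply {ι : Type*} (hF : IsDiagonalForm F c a) (V : Matrix (Fin t) ι ℂ) (x : Fin s)
    (y : ι) : (F * V) x y = if h : (x : ℕ) < t then (a (c x) : ℂ) * V ⟨x, h⟩ y else 0 := by
  rw [Matrix.mul_apply]
  split_ifs with h
  · rw [Finset.sum_eq_single ⟨x, h⟩]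
    · rw [hF.entry, if_pos rfl]
    · intro z _ hz
      rw [hF.entry, if_neg (fun h' => hz (Fin.ext h'.symm)), zero_mul]
    · simp
  · refine Finset.sum_eq_zero fun z _ => ?_
    have hz : (x : ℕ) ≠ z := by omega
    rw [hF.entry, if_neg hz, zero_mul]

theorem apply_mul {ι : Type*} (hF : IsDiagonalForm F c a) (U : Matrix ι (Fin s) ℂ) (x : ι)
    (y : Fin t) : (U * F) x y = if h : (y : ℕ) < s then U x ⟨y, h⟩ * (a (c y) : ℂ) else 0 := by
  rw [Matrix.mul_apply]
  split_ifs with h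
  · rw [Finset.sum_eq_single ⟨y, h⟩]
    · rw [hF.entry, if_pos rfl]
    · intro z _ hz
      rw [hF.entry, if_neg (fun h' => hz (Fin.ext h')), mul_zero]
    · simp
  · refine Finset.sum_eq_zero fun z _ => ?_
    have hz : (z : ℕ) ≠ y := by omega
    rw [hF.entry, if_neg hz, mul_zero]

theorem mul_conjTranspose_self (hF : IsDiagonalForm F c a) :
    F * Fᴴ = diagonal fun x : Fin s => ((a (c x) ^ 2 : ℝ) : ℂ) := by
  ext x y
  rw [hF.mul_apply, diagonal_apply]
  split_ifs with h h' h'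
  · subst h'
    rw [conjTranspose_apply, hF.entry, if_pos rfl]
    simp [sq]
  · rw [conjTranspose_apply, hF.entry, if_neg (fun h'' => h' (Fin.ext h''.symm))]
    simp
  · rw [hF.eq_zero (Or.inr (not_lt.1 h))]
    simp
  · rfl

/-- The transformation intertwines the Gram matrices, so its nonzero entries join equal values. -/
theorem eq_of_apply_ne_zero (hF : IsDiagonalForm F c a) (hF' : IsDiagonalForm F' c' a')
    {U : Matrix (Fin s) (Fin s) ℂ} {V : Matrix (Fin t) (Fin t) ℂ}
    (h : F * V = U * F') (h' : Fᴴ * U = V * F'ᴴ) {x y : Fin s} (hxy : U x y ≠ 0) :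
    a (c x) = a' (c' y) := by
  have h1 : F * Fᴴ * U = U * (F' * F'ᴴ) := by
    rw [Matrix.mul_assoc, h', ← Matrix.mul_assoc, h, Matrix.mul_assoc]
  rw [hF.mul_conjTranspose_self, hF'.mul_conjTranspose_self] at h1
  have h2 := congrFun (congrFun h1 x) y
  rw [diagonal_mul, mul_diagonal, mul_comm] at h2
  have h3 := Complex.ofReal_injective (mul_left_cancel₀ hxy h2)
  exact (sq_eq_sq₀ (hF.nonneg _) (hF'.nonneg _)).1 h3

theorem le_of_equiv (hF : IsDiagonalForm F c a) (hF' : IsDiagonalForm F' c' a')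
    {U U' : Matrix (Fin s) (Fin s) ℂ} {V : Matrix (Fin t) (Fin t) ℂ} (hU : U' * U = 1)
    (h : F * V = U * F') (h' : Fᴴ * U = V * F'ᴴ) (x : ℕ) (hx : x < s) : a' (c' x) ≤ a (c x) := by
  refine imp_of_mapsTo_support hU (P := fun y => a' (c' x) ≤ a' (c' y))
    (Q := fun y => a' (c' x) ≤ a (c y)) ?_ ?_ ?_ x hx le_rfl
  · exact fun y z hyz hz => hz.trans (hF'.strictAnti.antitone (hF'.mono hyz))
  · exact fun y z hyz hz => hz.trans (hF.strictAnti.antitone (hF.mono hyz))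
  · intro v hv y hy
    rw [Matrix.mulVec, dotProduct]
    refine Finset.sum_eq_zero fun z _ => ?_
    by_cases hz : U y z = 0
    · rw [hz, zero_mul]
    · rw [hv z, mul_zero]
      rwa [← hF.eq_of_apply_ne_zero hF' h h' hz]

theorem surjective (hF : IsDiagonalForm F c a) : Function.Surjective c := by
  intro i
  by_cases hi : i = Fin.last k
  · exact ⟨s, by rw [hi, hF.eq_last (Or.inl le_rfl)]⟩
  · exact hF.nonempty i hi

/-- Two diagonal forms that are unitarily equivalent coincide, and every unitary equivalence between
them is block diagonal with equal diagonal blocks at the nonzero values. -/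
theorem unique (hF : IsDiagonalForm F c a) (hF' : IsDiagonalForm F' c' a')
    {U : Matrix (Fin s) (Fin s) ℂ} (hU : U ∈ unitaryGroup (Fin s) ℂ)
    {V : Matrix (Fin t) (Fin t) ℂ} (hV : V ∈ unitaryGroup (Fin t) ℂ) (h : F * V = U * F') :
    k = k' ∧ HEq c c' ∧ HEq a a' ∧ (∀ x y : Fin s, c x ≠ c y → U x y = 0) ∧
      (∀ x y : Fin t, c x ≠ c y → V x y = 0) ∧
      ∀ (x y : Fin s) (x' y' : Fin t), (x : ℕ) = x' → (y : ℕ) = y' → c x = c y →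
        c x ≠ Fin.last k → U x y = V x' y' := by
  have hU1 : U * Uᴴ = 1 := mem_unitaryGroup_iff.1 hU
  have hU2 : Uᴴ * U = 1 := mem_unitaryGroup_iff'.1 hU
  have hV1 : V * Vᴴ = 1 := mem_unitaryGroup_iff.1 hV
  have hF'' : F' = Uᴴ * F * V := by
    rw [Matrix.mul_assoc, h, ← Matrix.mul_assoc, hU2, Matrix.one_mul]
  have h' : Fᴴ * U = V * F'ᴴ := by
    rw [hF'', conjTranspose_mul, conjTranspose_mul, conjTranspose_conjTranspose,
      ← Matrix.mul_assoc, hV1, Matrix.one_mul]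
  have hi : F' * Vᴴ = Uᴴ * F := by
    rw [hF'', Matrix.mul_assoc, hV1, Matrix.mul_one]
  have hi' : F'ᴴ * Uᴴ = Vᴴ * Fᴴ := by
    rw [← conjTranspose_mul, ← conjTranspose_mul, h]
  have hac : a ∘ c = a' ∘ c' := by
    ext x
    rcases lt_or_ge x s with hx | hx
    · exact le_antisymm (hF'.le_of_equiv hF (U := Uᴴ) (U' := U) (V := Vᴴ) hU1 hi hi' x hx)
        (hF.le_of_equiv hF' (V := V) hU2 h h' x hx)
    · rw [Function.comp_apply, Function.comp_apply, hF.eq_zero (Or.inl hx),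
        hF'.eq_zero (Or.inl hx)]
  have hrange : Set.range a = Set.range a' := by
    rw [← hF.surjective.range_comp, hac, hF'.surjective.range_comp]
  obtain rfl : k = k' := by
    have h1 := Set.ncard_congr' (Equiv.setCongr hrange)
    rw [← Set.image_univ, ← Set.image_univ, Set.ncard_image_of_injective _ hF.strictAnti.injective,
      Set.ncard_image_of_injective _ hF'.strictAnti.injective] at h1
    simpa using h1
  obtain rfl : a = a' := by
    have h1 := (hF.strictAnti.dual_right.range_inj hF'.strictAnti.dual_right).1 (by
      rw [Set.range_comp, Set.range_comp, hrange])
    exact funext fun i => OrderDual.toDual.injective (congrFun h1 i)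
  obtain rfl : c = c' := funext fun x => hF.strictAnti.injective (congrFun hac x)
  refine ⟨rfl, HEq.rfl, HEq.rfl, fun x y hxy => ?_, fun x y hxy => ?_,
    fun x y x' y' hx hy hxy hne => ?_⟩
  · by_contra h0
    exact hxy (hF.strictAnti.injective (hF.eq_of_apply_ne_zero hF' h h' h0))
  · by_contra h0
    exact hxy (hF.strictAnti.injective (hF.conjTranspose.eq_of_apply_ne_zero hF'.conjTranspose h'
      (by rwa [conjTranspose_conjTranspose, conjTranspose_conjTranspose]) h0))
  · have h1 := congrFun (congrFun h x) y'
    have hx' : (x : ℕ) < t := hx ▸ x'.2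
    have hy' : (y' : ℕ) < s := hy ▸ y.2
    rw [hF.mul_apply, hF'.apply_mul, dif_pos hx', dif_pos hy', mul_comm,
      show c y' = c x by rw [hxy, hy]] at h1
    have h2 : (a (c x) : ℂ) ≠ 0 := Complex.ofReal_ne_zero.2 (hF.pos hne).ne'
    have h3 := mul_right_cancel₀ h2 h1
    have e1 : (⟨x, hx'⟩ : Fin t) = x' := Fin.ext hx
    have e2 : (⟨y', hy'⟩ : Fin s) = y := Fin.ext hy.symm
    rw [e1, e2] at h3
    exact h3.symm

/-- Block diagonal matrices whose diagonal blocks agree at the nonzero values preserve a diagonal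
form. -/
theorem mul_eq_mul (hF : IsDiagonalForm F c a) {U : Matrix (Fin s) (Fin s) ℂ}
    {V : Matrix (Fin t) (Fin t) ℂ} (hU : ∀ x y : Fin s, c x ≠ c y → U x y = 0)
    (hV : ∀ x y : Fin t, c x ≠ c y → V x y = 0)
    (hUV : ∀ (x y : Fin s) (x' y' : Fin t), (x : ℕ) = x' → (y : ℕ) = y' → c x = c y →
        c x ≠ Fin.last k → U x y = V x' y') : F * V = U * F := by
  ext x y
  rw [hF.mul_apply, hF.apply_mul]
  by_cases hxy : c x = c y
  · by_cases hl : c x = Fin.last k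
    · have h1 : a (c y) = 0 := by rw [← hxy, hl, hF.last_eq]
      simp [hxy, h1]
    · have hx := (hF.lt_size _ hl).2
      have hy := (hF.lt_size _ (hxy ▸ hl)).1
      rw [dif_pos hx, dif_pos hy, hUV x ⟨y, hy⟩ ⟨x, hx⟩ y rfl rfl hxy hl, hxy, mul_comm]
  · have h1 : ∀ h, V ⟨x, h⟩ y = 0 := fun h => hV _ _ hxy
    have h2 : ∀ h, U x ⟨y, h⟩ = 0 := fun h => hU _ _ hxy
    simp [h1, h2]

end IsDiagonalForm

end DiagonalUniqueness

/-! ### Existence of the diagonal form -/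

section DiagonalExistence

open Matrix

/-- The matrix whose columns are the vectors of an orthonormal basis. -/
noncomputable def colMatrix {s : ℕ} (b : OrthonormalBasis (Fin s) ℂ (EuclideanSpace ℂ (Fin s))) :
    Matrix (Fin s) (Fin s) ℂ :=
  Matrix.of fun x j => b j x

theorem colMatrix_mem {s : ℕ} (b : OrthonormalBasis (Fin s) ℂ (EuclideanSpace ℂ (Fin s))) :
    colMatrix b ∈ unitaryGroup (Fin s) ℂ := by
  have h := (EuclideanSpace.basisFun (Fin s) ℂ).toMatrix_orthonormalBasis_mem_unitary b
  convert h using 1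
  ext x j
  simp [colMatrix, Module.Basis.toMatrix_apply]

theorem conjTranspose_colMatrix_mul_mul {s t : ℕ}
    (u : OrthonormalBasis (Fin s) ℂ (EuclideanSpace ℂ (Fin s)))
    (v : OrthonormalBasis (Fin t) ℂ (EuclideanSpace ℂ (Fin t))) (M : Matrix (Fin s) (Fin t) ℂ)
    (x : Fin s) (y : Fin t) :
    ((colMatrix u)ᴴ * M * colMatrix v) x y = inner ℂ (u x) (toLpLin 2 2 M (v y)) := by
  rw [Matrix.mul_assoc, EuclideanSpace.inner_eq_star_dotProduct, dotProduct_comm, toLpLin_apply]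
  rfl

/-- An antitone sequence that vanishes eventually takes finitely many values; list them in
decreasing order. -/
theorem exists_strictAnti_comp {τ : ℕ → ℝ} (hτ : Antitone τ) {N : ℕ} (hN : ∀ x, N ≤ x → τ x = 0) :
    ∃ (k : ℕ) (c : ℕ → Fin (k + 1)) (a : Fin (k + 1) → ℝ), Monotone c ∧ StrictAnti a ∧
      a (Fin.last k) = 0 ∧ Function.Surjective c ∧ ∀ x, τ x = a (c x) := by
  classical
  set Z := (Finset.range (N + 1)).image τ
  have hmem : ∀ x, τ x ∈ Z := by
    intro x
    rcases le_total x N with h | h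
    · exact Finset.mem_image_of_mem _ (by simp; omega)
    · rw [hN x h, ← hN N le_rfl]
      exact Finset.mem_image_of_mem _ (by simp)
  have h0 : ∀ z ∈ Z, 0 ≤ z := by
    intro z hz
    obtain ⟨x, hx, rfl⟩ := Finset.mem_image.1 hz
    rw [← hN N le_rfl]
    exact hτ (by simp at hx; omega)
  obtain ⟨k, hk⟩ : ∃ k, Z.card = k + 1 :=
    Nat.exists_eq_succ_of_ne_zero (Finset.card_ne_zero_of_mem (hmem 0))
  set e := Z.orderIsoOfFin hk
  refine ⟨k, fun x => (e.symm ⟨τ x, hmem x⟩).rev, fun i => e i.rev, ?_, ?_, ?_, ?_, ?_⟩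
  · intro x y hxy
    rw [Fin.rev_le_rev, e.symm.le_iff_le]
    exact hτ hxy
  · intro i j hij
    exact e.strictMono (Fin.rev_lt_rev.2 hij)
  · apply le_antisymm
    · have h1 : (⟨0, hN N le_rfl ▸ hmem N⟩ : Z) = e (e.symm ⟨0, hN N le_rfl ▸ hmem N⟩) :=
        (e.apply_symm_apply _).symm
      have h2 : e (Fin.last k).rev ≤ ⟨0, hN N le_rfl ▸ hmem N⟩ := by
        rw [h1, e.le_iff_le, Fin.rev_last]
        exact Fin.zero_le _
      exact h2
    · exact h0 _ (e _).2
  · intro i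
    obtain ⟨x, -, hx⟩ := Finset.mem_image.1 (e i.rev).2
    refine ⟨x, ?_⟩
    have : (⟨τ x, hmem x⟩ : Z) = e i.rev := Subtype.ext hx
    simp only [this, OrderIso.symm_apply_apply, Fin.rev_rev]
  · intro x
    simp

/-- The singular value decomposition. -/
theorem exists_isDiagonalForm {s t : ℕ} (M : Matrix (Fin s) (Fin t) ℂ) :
    ∃ U ∈ unitaryGroup (Fin s) ℂ, ∃ V ∈ unitaryGroup (Fin t) ℂ,
      ∃ (k : ℕ) (c : ℕ → Fin (k + 1)) (a : Fin (k + 1) → ℝ),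
        IsDiagonalForm (Uᴴ * M * V) c a := by
  set T := toLpLin 2 2 M
  have hn : Module.finrank ℂ (EuclideanSpace ℂ (Fin t)) = t := by simp
  set v := T.isSymmetric_adjoint_comp_self.eigenvectorBasis hn
  set σ : ℕ → ℝ := fun x => T.singularValues x
  have hσs : ∀ x, s ≤ x → σ x = 0 := fun x hx =>
    T.singularValues_eq_zero_iff_le_finrank_range.2
      ((T.range.finrank_le.trans (by simp)).trans hx)
  have hσt : ∀ x, t ≤ x → σ x = 0 := fun x hx =>
    T.singularValues_of_finrank_le (by simpa using hx)
  have hT : ∀ y z : Fin t, inner ℂ (T (v y)) (T (v z)) = ((σ z) ^ 2 : ℂ) * inner ℂ (v y) (v z) := by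
    intro y z
    rw [← LinearMap.adjoint_inner_right, ← LinearMap.comp_apply]
    have h1 := T.isSymmetric_adjoint_comp_self.apply_eigenvectorBasis hn z
    rw [h1, inner_smul_right, ← T.sq_singularValues_fin hn z]
    simp [σ, v]
  let u₀ : Fin s → EuclideanSpace ℂ (Fin s) := fun x =>
    if h : (x : ℕ) < t then ((σ x : ℂ)⁻¹) • T (v ⟨x, h⟩) else 0
  have hu₀ : Orthonormal ℂ (Set.domRestrict {x : Fin s | σ x ≠ 0} u₀) := by
    rw [orthonormal_iff_ite]
    rintro ⟨x, hx⟩ ⟨y, hy⟩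
    have hxt : (x : ℕ) < t := by
      by_contra h
      exact hx (hσt x (not_lt.1 h))
    have hyt : (y : ℕ) < t := by
      by_contra h
      exact hy (hσt y (not_lt.1 h))
    simp only [Set.domRestrict_apply, u₀, dif_pos hxt, dif_pos hyt, inner_smul_left,
      inner_smul_right, hT, orthonormal_iff_ite.1 v.orthonormal, Subtype.mk.injEq]
    by_cases hxy : x = y
    · subst hxy
      have : (σ x : ℂ) ≠ 0 := Complex.ofReal_ne_zero.2 hx
      simp
      field_simp
    · have : (x : ℕ) ≠ y := fun h => hxy (Fin.ext h)
      simp [hxy, this]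
  obtain ⟨u, hu⟩ := hu₀.exists_orthonormalBasis_extension_of_card_eq (by simp)
  obtain ⟨k, c, a, hc, ha, hlast, hsurj, hσ⟩ :=
    exists_strictAnti_comp (τ := σ) T.singularValues_antitone (N := s) hσs
  refine ⟨colMatrix u, colMatrix_mem u, colMatrix v, colMatrix_mem v, k, c, a, hc, ha, hlast,
    fun i _ => hsurj i, fun x hx => ?_, fun x y => ?_⟩
  · have h1 : σ x ≠ 0 := by
      rw [hσ, ← hlast]
      exact ha.injective.ne hx
    constructor
    · by_contra h
      exact h1 (hσs x (not_lt.1 h))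
    · by_contra h
      exact h1 (hσt x (not_lt.1 h))
  · rw [conjTranspose_colMatrix_mul_mul, ← hσ]
    by_cases hy : σ y = 0
    · have h1 : T (v y) = 0 := by
        rw [← inner_self_eq_zero (𝕜 := ℂ), hT, hy]
        simp
      have h2 : (if (x : ℕ) = y then (σ x : ℂ) else 0) = 0 := by
        split_ifs with h
        · rw [h, hy, Complex.ofReal_zero]
        · rfl
      rw [h2]
      exact (congrArg _ h1).trans (inner_zero_right _)
    · have hys : (y : ℕ) < s := by
        by_contra h
        exact hy (hσs y (not_lt.1 h))
      have h1 : T (v y) = (σ y : ℂ) • u ⟨y, hys⟩ := by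
        rw [hu ⟨y, hys⟩ hy]
        simp only [u₀, dif_pos y.2]
        rw [smul_smul, mul_inv_cancel₀ (Complex.ofReal_ne_zero.2 hy), one_smul]
      refine (congrArg (inner ℂ (u x)) h1).trans ?_
      rw [inner_smul_right, orthonormal_iff_ite.1 u.orthonormal]
      by_cases hxy : (x : ℕ) = y
      · have : x = ⟨y, hys⟩ := Fin.ext hxy
        rw [if_pos this, if_pos hxy, mul_one, hxy]
      · have : x ≠ ⟨y, hys⟩ := fun h => hxy (congrArg Fin.val h)
        rw [if_neg this, if_neg hxy, mul_zero]

end DiagonalExistence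

/-! ### Existence of the triangular form -/

section TriangularExistence

open Matrix

theorem lexLE_trans {z w u : ℂ} (h : lexLE z w) (h' : lexLE w u) : lexLE z u := by
  rcases h with ⟨h, h1⟩ | h <;> rcases h' with ⟨h', h1'⟩ | h'
  · exact Or.inl ⟨h.trans h', h1.trans h1'⟩
  · exact Or.inr (h.trans_lt h')
  · exact Or.inr (h.trans_eq h')
  · exact Or.inr (h.trans h')

/-- A nonempty finite set of complex numbers has a greatest element. -/
theorem exists_max_lexLE {X : Set ℂ} (hX : X.Finite) (hne : X.Nonempty) :
    ∃ z ∈ X, ∀ w ∈ X, lexLE w z := by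
  obtain ⟨z, hz, hmax⟩ := Set.exists_max_image X
    (fun z : ℂ => toLex (z.re, z.im)) hX hne
  refine ⟨z, hz, fun w hw => ?_⟩
  rcases Prod.Lex.toLex_le_toLex.1 (hmax w hw) with h | h
  · exact Or.inr h
  · exact Or.inl h

/-- An orthonormal basis `b` in which the operator `T` is block triangular as in
`IsTriangularForm`: the basis vector `b x` belongs to the strip number `g x < K`, but the strips
need not be consecutive.  The field `first` says that the strip number `0` spans the eigenspace of
`lam 0`. -/
structure IsAdapted {E ι : Type} [NormedAddCommGroup E] [InnerProductSpace ℂ E] [Fintype ι]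
    (T : E →ₗ[ℂ] E) (b : OrthonormalBasis ι ℂ E) (K : ℕ) (g : ι → ℕ) (lam : ℕ → ℂ) : Prop where
  lt : ∀ x, g x < K
  surj : ∀ α < K, ∃ x, g x = α
  anti : ∀ α β, α ≤ β → β < K → lexLE (lam β) (lam α)
  lower : ∀ x y, g y < g x → inner ℂ (b x) (T (b y)) = 0
  diag : ∀ x y, g x = g y → inner ℂ (b x) (T (b y)) = lam (g x) * inner ℂ (b x) (b y)
  first : 0 < K → ∀ v, T v = lam 0 • v ↔ ∀ y, g y ≠ 0 → inner ℂ (b y) v = 0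
  indep : ∀ α, α + 1 < K → lam α = lam (α + 1) → ∀ v, (∀ y, g y ≠ α + 1 → inner ℂ (b y) v = 0) →
    (∀ x, g x = α → inner ℂ (b x) (T v) = 0) → v = 0

theorem OrthonormalBasis.eq_zero_of_inner {E ι : Type} [NormedAddCommGroup E]
    [InnerProductSpace ℂ E] [Fintype ι] (b : OrthonormalBasis ι ℂ E) {v : E}
    (h : ∀ x, inner ℂ (b x) v = 0) : v = 0 := by
  rw [← b.sum_repr' v]
  exact Finset.sum_eq_zero fun x _ => by rw [h x, zero_smul]

/-- Every operator has an adapted orthonormal basis: take an orthonormal basis of the eigenspace of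
the greatest eigenvalue, and an adapted basis of its orthogonal complement for the compression of
the operator. -/
theorem exists_isAdapted (n : ℕ) : ∀ (E : Type) [NormedAddCommGroup E] [InnerProductSpace ℂ E]
    [FiniteDimensional ℂ E], Module.finrank ℂ E = n → ∀ T : E →ₗ[ℂ] E,
    ∃ (ι : Type) (_ : Fintype ι) (b : OrthonormalBasis ι ℂ E) (K : ℕ) (g : ι → ℕ) (lam : ℕ → ℂ),
      IsAdapted T b K g lam := by
  induction n using Nat.strong_induction_on with
  | _ n ih =>
  intro E _ _ _ hE T
  rcases Nat.eq_zero_or_pos n with rfl | hn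
  · refine ⟨Fin 0, inferInstance, (stdOrthonormalBasis ℂ E).reindex (finCongr hE), 0, fun _ => 0,
      fun _ => 0, fun x => x.elim0, ?_, ?_, fun x => x.elim0, fun x => x.elim0, ?_, ?_⟩
    · intro α hα; omega
    · intro α β _ hβ; omega
    · intro h; omega
    · intro α hα; omega
  have : Nontrivial E := Module.nontrivial_of_finrank_pos (R := ℂ) (by omega)
  obtain ⟨μ, hμ, hmax⟩ := exists_max_lexLE (Module.End.finite_hasEigenvalue T)
    (Module.End.exists_eigenvalue T)
  set W := Module.End.eigenspace T μ
  have hWpos : 0 < Module.finrank ℂ W := by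
    rw [Module.finrank_pos_iff, Submodule.nontrivial_iff_ne_bot]
    exact hμ
  have hfr := W.finrank_add_finrank_orthogonal
  set T₂ : Wᗮ →ₗ[ℂ] Wᗮ :=
    (Wᗮ.orthogonalProjectionOnto : E →ₗ[ℂ] Wᗮ) ∘ₗ T ∘ₗ Wᗮ.subtype
  have hT₂ : ∀ w w' : Wᗮ, inner ℂ w (T₂ w') = inner ℂ (w : E) (T w') := fun w w' =>
    Submodule.inner_orthogonalProjectionOnto_eq_of_mem_left w (T w')
  obtain ⟨ι₂, _, b₂, K, g₂, lam₂, h₂⟩ := ih _ (by omega) Wᗮ rfl T₂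
  set b₁ := stdOrthonormalBasis ℂ W
  set b : OrthonormalBasis (Fin (Module.finrank ℂ W) ⊕ ι₂) ℂ E :=
    (b₁.prod b₂).map W.orthogonalDecomposition.symm with hb
  have hD : ∀ z : WithLp 2 (W × Wᗮ), W.orthogonalDecomposition.symm z = (z.fst : E) + z.snd := by
    intro z
    change W.orthogonalDecomposition.symm.toLinearEquiv z = _
    rw [Submodule.toLinearEquiv_orthogonalDecomposition_symm]
    simp
  have hb1 : ∀ i, b (Sum.inl i) = b₁ i := by
    intro i
    rw [hb, OrthonormalBasis.map_apply, hD, OrthonormalBasis.prod_apply]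
    simp
  have hb2 : ∀ i, b (Sum.inr i) = b₂ i := by
    intro i
    rw [hb, OrthonormalBasis.map_apply, hD, OrthonormalBasis.prod_apply]
    simp
  have hT1 : ∀ w : W, T w = μ • (w : E) := fun w => Module.End.mem_eigenspace_iff.1 w.2
  have horth : ∀ (w : W) (w' : Wᗮ), inner ℂ (w' : E) (w : E) = 0 := fun w w' =>
    Submodule.inner_left_of_mem_orthogonal w.2 w'.2
  have horth' : ∀ (w : W) (w' : Wᗮ), inner ℂ (w : E) (w' : E) = 0 := fun w w' =>
    Submodule.inner_right_of_mem_orthogonal w.2 w'.2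
  have hmemW : ∀ v, (∀ j, inner ℂ (b₂ j : E) v = 0) → v ∈ W := by
    intro v hv
    rw [← W.orthogonal_orthogonal, ← Submodule.orthogonalProjectionOnto_eq_zero_iff]
    apply b₂.eq_zero_of_inner
    intro j
    rw [Submodule.inner_orthogonalProjectionOnto_eq_of_mem_left, hv]
  have hmemW' : ∀ v, (∀ i, inner ℂ (b₁ i : E) v = 0) → v ∈ Wᗮ := by
    intro v hv
    rw [← Submodule.orthogonalProjectionOnto_eq_zero_iff]
    apply b₁.eq_zero_of_inner
    intro j
    rw [Submodule.inner_orthogonalProjectionOnto_eq_of_mem_left, hv]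
  refine ⟨_, inferInstance, b, K + 1, Sum.elim (fun _ => 0) (fun j => g₂ j + 1),
    fun α => Nat.casesOn α μ lam₂, ?_, ?_, ?_, ?_, ?_, ?_, ?_⟩
  · rintro (i | j)
    · exact Nat.succ_pos _
    · exact Nat.succ_lt_succ (h₂.lt j)
  · rintro (_ | α) hα
    · exact ⟨Sum.inl ⟨0, hWpos⟩, rfl⟩
    · obtain ⟨j, hj⟩ := h₂.surj α (Nat.lt_of_succ_lt_succ hα)
      exact ⟨Sum.inr j, congrArg (· + 1) hj⟩
  · -- An eigenvector of the compression gives an eigenvector of `T`.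
    have h0 : 0 < K → lexLE (lam₂ 0) μ := by
      intro hK
      by_cases hne : lam₂ 0 = μ
      · exact Or.inl (by rw [hne]; exact ⟨rfl, le_rfl⟩)
      obtain ⟨j, hj⟩ := h₂.surj 0 hK
      have hev : T₂ (b₂ j) = lam₂ 0 • b₂ j := (h₂.first hK _).2 fun y hy => by
        classical
        rw [orthonormal_iff_ite.1 b₂.orthonormal, if_neg (by rintro rfl; exact hy hj)]
      have hu : T (b₂ j) - lam₂ 0 • (b₂ j : E) ∈ W := hmemW _ fun y => by
        rw [inner_sub_right, inner_smul_right, ← hT₂, hev, inner_smul_right,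
          Submodule.coe_inner, sub_self]
      set u : W := ⟨_, hu⟩
      have hu' : T (b₂ j) = lam₂ 0 • (b₂ j : E) + (u : E) := by simp [u]
      refine hmax _ (Module.End.hasEigenvalue_of_hasEigenvector
        (x := (b₂ j : E) + ((lam₂ 0 - μ)⁻¹ • u : W)) ⟨?_, ?_⟩)
      · rw [Module.End.mem_eigenspace_iff, map_add, hT1, hu', smul_add, add_assoc]
        congr 1
        have h3 : lam₂ 0 - μ ≠ 0 := sub_ne_zero.2 hne
        rw [Submodule.coe_smul, smul_smul, smul_smul]
        nth_rw 1 [← one_smul ℂ (u : E)]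
        rw [← add_smul]
        congr 1
        field_simp
        ring
      · intro h4
        have h5 := congrArg (inner ℂ (b₂ j : E)) h4
        rw [inner_add_right, horth, add_zero, inner_zero_right, ← Submodule.coe_inner,
          inner_self_eq_zero] at h5
        exact b₂.orthonormal.ne_zero j h5
    rintro (_ | α) (_ | β) hαβ hβ
    · exact Or.inl ⟨rfl, le_rfl⟩
    · exact lexLE_trans (h₂.anti 0 β (Nat.zero_le _) (by omega)) (h0 (by omega))
    · omega
    · exact h₂.anti α β (by omega) (by omega)
  · rintro (i | i) (j | j) hij
    · simp at hij
    · simp at hij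
    · rw [hb1, hb2, hT1, inner_smul_right, horth, mul_zero]
    · rw [hb2, hb2, ← hT₂, h₂.lower _ _ (by simpa using hij)]
  · rintro (i | i) (j | j) hij
    · rw [hb1, hb1, hT1, inner_smul_right]
      rfl
    · simp at hij
    · simp at hij
    · rw [hb2, hb2, ← hT₂, h₂.diag _ _ (by simpa using hij)]
      rfl
  · intro _ v
    rw [← Module.End.mem_eigenspace_iff]
    constructor
    · rintro hv (i | j) hi
      · exact absurd rfl hi
      · rw [hb2]
        exact horth ⟨v, hv⟩ _
    · intro hv
      refine hmemW _ fun j => ?_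
      rw [← hb2]
      exact hv (Sum.inr j) (Nat.succ_ne_zero _)
  · rintro α hα hlam v hv hTv
    have hvW : v ∈ Wᗮ := hmemW' v fun i => by
      rw [← hb1]
      exact hv (Sum.inl i) (Nat.succ_ne_zero _).symm
    suffices h : (⟨v, hvW⟩ : Wᗮ) = 0 from congrArg Subtype.val h
    rcases α with _ | α
    · -- The vector lies in the eigenspace and in its orthogonal complement.
      have h1 : T₂ ⟨v, hvW⟩ = lam₂ 0 • ⟨v, hvW⟩ := (h₂.first (by omega) _).2 fun y hy => by
        have := hv (Sum.inr y) (by simpa using hy)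
        rwa [hb2] at this
      have h2 : T v - μ • v ∈ Wᗮ := hmemW' _ fun i => by
        have := hTv (Sum.inl i) rfl
        rw [hb1] at this
        rw [inner_sub_right, this, inner_smul_right, horth' (b₁ i) ⟨v, hvW⟩, mul_zero, sub_zero]
      have h3 : T v - μ • v ∈ W := hmemW _ fun j => by
        rw [inner_sub_right, ← hT₂ (b₂ j) ⟨v, hvW⟩, h1, inner_smul_right, inner_smul_right,
          ← show μ = lam₂ 0 from hlam, Submodule.coe_inner, sub_self]
      have h4 : T v - μ • v = 0 := by
        rw [← inner_self_eq_zero (𝕜 := ℂ)]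
        exact horth ⟨_, h3⟩ ⟨_, h2⟩
      have h5 : v ∈ W := Module.End.mem_eigenspace_iff.2 (sub_eq_zero.1 h4)
      rw [← inner_self_eq_zero (𝕜 := ℂ)]
      exact horth ⟨v, h5⟩ ⟨v, hvW⟩
    · refine h₂.indep α (by omega) hlam _ (fun y hy => ?_) fun x hx => ?_
      · have := hv (Sum.inr y) (by simpa using hy)
        rwa [hb2] at this
      · have := hTv (Sum.inr x) (by simpa using hx)
        rwa [hb2, ← hT₂ (b₂ x) ⟨v, hvW⟩] at this

/-- Every square matrix of positive size is unitarily similar to a triangular form. -/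
theorem exists_isTriangularForm {s : ℕ} (hs : 0 < s) (M : Matrix (Fin s) (Fin s) ℂ) :
    ∃ U ∈ unitaryGroup (Fin s) ℂ,
      ∃ (k : ℕ) (c : ℕ → Fin (k + 1)) (lam : Fin (k + 1) → ℂ),
        IsTriangularForm (Uᴴ * M * U) c lam := by
  obtain ⟨ι, _, b₀, K, g₀, lam, h⟩ :=
    exists_isAdapted s (EuclideanSpace ℂ (Fin s)) (by simp) (toLpLin 2 2 M)
  have hcard : Fintype.card ι = s := by
    rw [← Module.finrank_eq_card_basis b₀.toBasis]
    simp
  -- Sort the basis vectors by the numbers of their strips.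
  let e₀ : ι ≃ Fin s := Fintype.equivFinOfCardEq hcard
  let e : Fin s ≃ ι := (Tuple.sort (g₀ ∘ e₀.symm)).trans e₀.symm
  let b := b₀.reindex e.symm
  let g : Fin s → ℕ := g₀ ∘ e
  have hg : Monotone g := Tuple.monotone_sort (g₀ ∘ e₀.symm)
  have hbe : ∀ x, b x = b₀ (e x) := fun x => by simp [b]
  obtain ⟨k, rfl⟩ : ∃ k, K = k + 1 :=
    Nat.exists_eq_succ_of_ne_zero (Nat.ne_of_gt ((Nat.zero_le _).trans_lt (h.lt (e ⟨0, hs⟩))))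
  let c : ℕ → Fin (k + 1) := fun x =>
    if hx : x < s then ⟨g ⟨x, hx⟩, h.lt _⟩ else Fin.last k
  have hc : ∀ x : Fin s, (c x : ℕ) = g x := fun x => by simp [c]
  refine ⟨colMatrix b, colMatrix_mem b, k, c, fun i => lam i, ?_, ?_, ?_, ?_, ?_, ?_⟩
  · intro x y hxy
    by_cases hy : y < s
    · have hx : x < s := hxy.trans_lt hy
      have h1 : g ⟨x, hx⟩ ≤ g ⟨y, hy⟩ := hg hxy
      simpa [c, hx, hy] using h1
    · simp only [c, dif_neg hy]
      exact Fin.le_last _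
  · intro i
    obtain ⟨x, hx⟩ := h.surj i i.2
    refine ⟨e.symm x, Fin.ext ?_⟩
    rw [hc, ← hx]
    simp [g]
  · intro i j hij
    exact h.anti i j hij j.2
  · intro x y hxy
    rw [conjTranspose_colMatrix_mul_mul, hbe, hbe]
    refine h.lower _ _ ?_
    rw [Fin.lt_def, hc, hc] at hxy
    exact hxy
  · intro x y hxy
    have hxy' : g x = g y := by rw [← hc, ← hc, hxy]
    rw [conjTranspose_colMatrix_mul_mul, hbe, hbe]
    refine (h.diag _ _ hxy').trans ?_
    rw [← hbe, ← hbe, orthonormal_iff_ite.1 b.orthonormal, hc]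
    simp [g]
  · intro i hi
    classical
    rw [Fintype.linearIndependent_iff]
    intro w hw
    let w' : Fin s → ℂ := fun y => if hy : c y = i.succ then w ⟨y, hy⟩ else 0
    have hin : ∀ x, inner ℂ (b x) (∑ y, w' y • b y) = w' x := fun x => by
      rw [inner_sum]
      simp only [inner_smul_right, orthonormal_iff_ite.1 b.orthonormal]
      simp
    have hv : (∑ y, w' y • b y) = 0 := by
      refine h.indep i (by omega) (by simpa using hi) _ (fun y hy => ?_) (fun x hx => ?_)
      · obtain ⟨y, rfl⟩ := e.surjective y
        rw [← hbe, hin]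
        refine dif_neg fun h' => hy ?_
        have := hc y
        rw [h', Fin.val_succ] at this
        exact this.symm
      · obtain ⟨x, rfl⟩ := e.surjective x
        have hx' : c x = i.castSucc := Fin.ext (by rw [hc]; exact hx)
        have h1 := congrFun hw ⟨x, hx'⟩
        rw [Finset.sum_apply] at h1
        rw [map_sum, inner_sum, ← hbe,
          ← Fintype.sum_subtype_add_sum_subtype (fun y : Fin s => c y = i.succ)]
        refine (congrArg₂ _ ?_ ?_).trans (add_zero _)
        · refine Eq.trans (Finset.sum_congr rfl fun y _ => ?_) h1
          rw [map_smul, inner_smul_right, ← conjTranspose_colMatrix_mul_mul]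
          simp [w', y.2]
        · refine Finset.sum_eq_zero fun y _ => ?_
          simp [w', y.2]
    rintro ⟨y, hy⟩
    have h1 := hin y
    rw [hv, inner_zero_right] at h1
    simpa [w', hy] using h1.symm

end TriangularExistence

/-! ### Strips and the blocks on the diagonal -/

section StripLemmas

open Matrix

variable {m n l r : ℕ} {f : Fin m → Fin l} {g : Fin n → Fin r}

theorem apply_stripEmb (f : Fin m → Fin l) (i : Fin l) (t : Fin (stripSize f i)) :
    f (stripEmb f i t) = i :=
  (Finset.mem_filter.1 ((strip f i).orderEmbOfFin_mem rfl t)).2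

theorem stripPos_lt_iff {x y : Fin m} (h : f x = f y) : stripPos f x < stripPos f y ↔ x < y := by
  refine ⟨fun hlt => ?_, stripPos_lt h⟩
  by_contra hle
  rcases (not_lt.1 hle).eq_or_lt with h' | h'
  · exact absurd (congrArg (stripPos f) h') hlt.ne'
  · exact absurd (stripPos_lt h.symm h') hlt.asymm

theorem eq_of_stripPos_eq {x y : Fin m} (h : f x = f y) (hpos : stripPos f x = stripPos f y) :
    x = y := by
  rcases lt_trichotomy x y with h' | h' | h'
  · exact absurd hpos (stripPos_lt h h').ne
  · exact h'
  · exact absurd hpos (stripPos_lt h.symm h').ne'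

theorem stripPos_lt_stripSize {x : Fin m} {i : Fin l} (h : f x = i) :
    stripPos f x < stripSize f i := by
  rw [← Finset.mem_range, ← image_stripPos]
  exact Finset.mem_image_of_mem _ (by simp [strip, h])

theorem stripPos_stripEmb (f : Fin m → Fin l) (i : Fin l) (t : Fin (stripSize f i)) :
    stripPos f (stripEmb f i t) = t := by
  have h1 : Finset.univ.filter (fun y => f y = f (stripEmb f i t) ∧ y < stripEmb f i t) =
      (Finset.univ.filter fun u => u < t).map (stripEmb f i).toEmbedding := by
    ext y
    simp only [Finset.mem_filter, Finset.mem_univ, true_and, apply_stripEmb, Finset.mem_map,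
      RelEmbedding.coe_toEmbedding]
    constructor
    · rintro ⟨hy, hlt⟩
      have : y ∈ Set.range (stripEmb f i) := by
        have hr : Set.range (stripEmb f i) = strip f i := Finset.range_orderEmbOfFin _ rfl
        rw [hr]
        simp [strip, hy]
      obtain ⟨u, rfl⟩ := this
      exact ⟨u, by simpa using hlt, rfl⟩
    · rintro ⟨u, hu, rfl⟩
      exact ⟨apply_stripEmb f i u, by simpa using hu⟩
  rw [stripPos, h1, Finset.card_map]
  refine Eq.trans (congrArg Finset.card ?_) (Fin.card_Iio t)
  ext u
  simp

theorem stripEmb_stripPos {x : Fin m} {i : Fin l} (h : f x = i) :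
    stripEmb f i ⟨stripPos f x, stripPos_lt_stripSize h⟩ = x :=
  eq_of_stripPos_eq ((apply_stripEmb f i _).trans h.symm) (stripPos_stripEmb f i _)

theorem sum_stripEmb {φ : Fin m → ℂ} (i : Fin l) (h : ∀ x, f x ≠ i → φ x = 0) :
    ∑ x, φ x = ∑ t, φ (stripEmb f i t) := by
  symm
  refine Finset.sum_of_injOn (stripEmb f i) (stripEmb f i).injective.injOn (by simp) ?_
    (fun _ _ => rfl)
  intro x _ hx
  apply h
  rintro rfl
  exact hx ⟨_, by simp, stripEmb_stripPos rfl⟩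

/-- The entries of a square matrix, extended by zero to all pairs of natural numbers.  Blocks of
strips with propositionally equal sizes are compared through these functions. -/
noncomputable def natEntry {s : ℕ} (M : Matrix (Fin s) (Fin s) ℂ) (u v : ℕ) : ℂ :=
  if h : u < s ∧ v < s then M ⟨u, h.1⟩ ⟨v, h.2⟩ else 0

theorem natEntry_coe {s : ℕ} (M : Matrix (Fin s) (Fin s) ℂ) (u v : Fin s) :
    natEntry M u v = M u v :=
  dif_pos ⟨u.2, v.2⟩

theorem natEntry_eq_iff {s t : ℕ} (h : s = t) {M : Matrix (Fin s) (Fin s) ℂ}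
    {N : Matrix (Fin t) (Fin t) ℂ} :
    natEntry M = natEntry N ↔ M = N.submatrix (Fin.cast h) (Fin.cast h) := by
  subst h
  constructor
  · intro h
    ext u v
    exact (natEntry_coe M u v).symm.trans ((congrFun (congrFun h u) v).trans (natEntry_coe N u v))
  · rintro rfl
    rfl

/-- The entries of the `i`-th diagonal block, as a function on pairs of natural numbers. -/
noncomputable def stripEntry (f : Fin m → Fin l) (R : Matrix (Fin m) (Fin m) ℂ) (i : Fin l) :
    ℕ → ℕ → ℂ :=
  natEntry (R.submatrix (stripEmb f i) (stripEmb f i))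

theorem stripEntry_coe (R : Matrix (Fin m) (Fin m) ℂ) (i : Fin l) (u v : Fin (stripSize f i)) :
    stripEntry f R i u v = R (stripEmb f i u) (stripEmb f i v) :=
  natEntry_coe _ u v

theorem stripEntry_of_not_lt (R : Matrix (Fin m) (Fin m) ℂ) (i : Fin l) {u v : ℕ}
    (h : ¬ (u < stripSize f i ∧ v < stripSize f i)) : stripEntry f R i u v = 0 :=
  dif_neg h

theorem stripEntry_stripPos (R : Matrix (Fin m) (Fin m) ℂ) {i : Fin l} {x y : Fin m}
    (hx : f x = i) (hy : f y = i) :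
    stripEntry f R i (stripPos f x) (stripPos f y) = R x y := by
  have := stripEntry_coe R i ⟨_, stripPos_lt_stripSize hx⟩ ⟨_, stripPos_lt_stripSize hy⟩
  rwa [stripEmb_stripPos hx, stripEmb_stripPos hy] at this

theorem stripEntry_add (R R' : Matrix (Fin m) (Fin m) ℂ) (i : Fin l) :
    stripEntry f (R + R') i = stripEntry f R i + stripEntry f R' i := by
  ext u v
  simp only [stripEntry, natEntry, Pi.add_apply]
  split_ifs <;> simp

theorem stripEntry_smul (z : ℂ) (R : Matrix (Fin m) (Fin m) ℂ) (i : Fin l) :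
    stripEntry f (z • R) i = z • stripEntry f R i := by
  ext u v
  simp only [stripEntry, natEntry, Pi.smul_apply]
  split_ifs <;> simp

theorem stripEntry_zero (i : Fin l) : stripEntry f (0 : Matrix (Fin m) (Fin m) ℂ) i = 0 := by
  ext u v
  simp [stripEntry, natEntry]

theorem stripEntry_eq_iff {i : Fin l} {j : Fin r} (hsz : stripSize f i = stripSize g j)
    {R : Matrix (Fin m) (Fin m) ℂ} {S : Matrix (Fin n) (Fin n) ℂ} :
    stripEntry f R i = stripEntry g S j ↔ ∀ x x' y y', f x = i → f x' = i → g y = j → g y' = j →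
      stripPos f x = stripPos g y → stripPos f x' = stripPos g y' → R x x' = S y y' := by
  constructor
  · intro h x x' y y' hx hx' hy hy' hxy hxy'
    rw [← stripEntry_stripPos R hx hx', h, hxy, hxy', stripEntry_stripPos S hy hy']
  · intro h
    ext u v
    by_cases huv : u < stripSize f i ∧ v < stripSize f i
    · have huv' : u < stripSize g j ∧ v < stripSize g j := by rwa [← hsz]
      have h1 := stripEntry_coe R i ⟨u, huv.1⟩ ⟨v, huv.2⟩
      have h2 := stripEntry_coe S j ⟨u, huv'.1⟩ ⟨v, huv'.2⟩
      refine h1.trans (Eq.trans ?_ h2.symm)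
      apply h <;> first | exact apply_stripEmb _ _ _ | (rw [stripPos_stripEmb, stripPos_stripEmb])
    · rw [stripEntry_of_not_lt _ _ huv, stripEntry_of_not_lt _ _ (by rwa [← hsz])]

theorem stripPos_cutLabel {k : ℕ} (f : Fin m → Fin l) (C : Fin l → ℕ → Fin (k + 1)) (x : Fin m) :
    stripPos (cutLabel f C) x =
      Nat.count (fun t => C (f x) t = C (f x) (stripPos f x)) (stripPos f x) := by
  rw [Nat.count_eq_card_filter_range, stripPos]
  refine Finset.card_nbij (stripPos f) ?_ ?_ ?_
  · intro y hy
    simp only [cutLabel, Finset.mem_filter, Finset.mem_univ, true_and,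
      EmbeddingLike.apply_eq_iff_eq, Prod.mk.injEq, Finset.mem_coe, Finset.mem_range] at hy ⊢
    obtain ⟨⟨h1, h2⟩, h3⟩ := hy
    exact ⟨(stripPos_lt_iff h1).2 h3, by rw [← h2, h1]⟩
  · intro y hy z hz hyz
    simp only [cutLabel, Finset.coe_filter, Finset.mem_univ, true_and, Set.mem_ofPred_eq,
      EmbeddingLike.apply_eq_iff_eq, Prod.mk.injEq] at hy hz
    exact eq_of_stripPos_eq (hy.1.1.trans hz.1.1.symm) hyz
  · intro t ht
    simp only [Finset.coe_filter, Finset.mem_range, Set.mem_ofPred_eq] at ht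
    have h1 : t < stripSize f (f x) := ht.1.trans (stripPos_lt_stripSize rfl)
    have h2 : f (stripEmb f (f x) ⟨t, h1⟩) = f x := apply_stripEmb _ _ _
    have h3 : stripPos f (stripEmb f (f x) ⟨t, h1⟩) = t := stripPos_stripEmb _ _ _
    refine ⟨stripEmb f (f x) ⟨t, h1⟩, ?_, h3⟩
    simp only [cutLabel, Finset.coe_filter, Finset.mem_univ, true_and, Set.mem_ofPred_eq,
      EmbeddingLike.apply_eq_iff_eq, Prod.mk.injEq]
    refine ⟨⟨h2, ?_⟩, (stripPos_lt_iff h2).1 (by rw [h3]; exact ht.1)⟩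
    rw [h3, h2]
    exact ht.2

theorem cutLabel_eq_iff {k : ℕ} {C : Fin l → ℕ → Fin (k + 1)} {x : Fin m} {i : Fin l}
    {a : Fin (k + 1)} : cutLabel f C x = finProdFinEquiv (i, a) ↔
      f x = i ∧ C i (stripPos f x) = a := by
  simp only [cutLabel, EmbeddingLike.apply_eq_iff_eq, Prod.mk.injEq]
  constructor <;> (rintro ⟨rfl, h⟩; exact ⟨rfl, h⟩)

/-- A matrix is block diagonal for the cut division iff it is block diagonal for the original
division and its diagonal blocks are block diagonal for the cutting functions. -/
theorem cut_diag_iff {k : ℕ} {C : Fin l → ℕ → Fin (k + 1)} {R : Matrix (Fin m) (Fin m) ℂ} :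
    (∀ x x', cutLabel f C x ≠ cutLabel f C x' → R x x' = 0) ↔
      (∀ x x', f x ≠ f x' → R x x' = 0) ∧
        ∀ i u v, C i u ≠ C i v → stripEntry f R i u v = 0 := by
  constructor
  · intro h
    refine ⟨fun x x' hx => h x x' fun h' => hx ?_, fun i u v huv => ?_⟩
    · exact (cutLabel_eq_iff.1 h').1
    · by_cases hlt : u < stripSize f i ∧ v < stripSize f i
      · refine (stripEntry_coe R i ⟨u, hlt.1⟩ ⟨v, hlt.2⟩).trans (h _ _ fun h' => huv ?_)
        have h1 := (cutLabel_eq_iff.1 h').2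
        rwa [apply_stripEmb f i ⟨v, hlt.2⟩, stripPos_stripEmb f i ⟨u, hlt.1⟩,
          stripPos_stripEmb f i ⟨v, hlt.2⟩] at h1
      · exact stripEntry_of_not_lt _ _ hlt
  · rintro ⟨h1, h2⟩ x x' hx
    by_cases h : f x = f x'
    · rw [← stripEntry_stripPos R h rfl]
      exact h2 _ _ _ fun h' => hx (cutLabel_eq_iff.2 ⟨h, h'⟩)
    · exact h1 x x' h

/-- Two substrips cut out in the same way have equal diagonal blocks iff the corresponding entries
of the diagonal blocks of the whole strips are equal. -/
theorem stripEntry_cutLabel_eq_iff {k : ℕ} {C : Fin l → ℕ → Fin (k + 1)}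
    {C' : Fin r → ℕ → Fin (k + 1)} {i : Fin l} {j : Fin r} {c : ℕ → Fin (k + 1)}
    {a : Fin (k + 1)} (hC : C i = c) (hC' : C' j = c)
    (hsz : ∀ t, c t = a → (t < stripSize f i ↔ t < stripSize g j))
    {R : Matrix (Fin m) (Fin m) ℂ} {S : Matrix (Fin n) (Fin n) ℂ} :
    stripEntry (cutLabel f C) R (finProdFinEquiv (i, a)) =
        stripEntry (cutLabel g C') S (finProdFinEquiv (j, a)) ↔
      ∀ u v, c u = a → c v = a → stripEntry f R i u v = stripEntry g S j u v := by
  subst hC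
  have hsize : stripSize (cutLabel f C) (finProdFinEquiv (i, a)) =
      stripSize (cutLabel g C') (finProdFinEquiv (j, a)) := by
    rw [stripSize_cutLabel, stripSize_cutLabel, hC']
    congr 1
    ext t
    simp only [Finset.mem_filter, Finset.mem_range]
    exact and_congr_left fun h => hsz t h
  have hposf : ∀ x, f x = i → C i (stripPos f x) = a → stripPos (cutLabel f C) x =
      Nat.count (fun t => C i t = a) (stripPos f x) := by
    rintro x rfl rfl
    exact stripPos_cutLabel f C x
  have hposg : ∀ y, g y = j → C i (stripPos g y) = a → stripPos (cutLabel g C') y =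
      Nat.count (fun t => C i t = a) (stripPos g y) := by
    rintro y rfl rfl
    rw [stripPos_cutLabel, hC']
  rw [stripEntry_eq_iff hsize]
  simp only [cutLabel_eq_iff, hC']
  constructor
  · intro h u v hu hv
    by_cases huv : u < stripSize f i ∧ v < stripSize f i
    · have huv' : u < stripSize g j ∧ v < stripSize g j := by rwa [← hsz u hu, ← hsz v hv]
      have h1 := stripEntry_coe R i ⟨u, huv.1⟩ ⟨v, huv.2⟩
      have h2 := stripEntry_coe S j ⟨u, huv'.1⟩ ⟨v, huv'.2⟩
      refine h1.trans (Eq.trans ?_ h2.symm)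
      have fu : f (stripEmb f i ⟨u, huv.1⟩) = i := apply_stripEmb _ _ _
      have fv : f (stripEmb f i ⟨v, huv.2⟩) = i := apply_stripEmb _ _ _
      have gu : g (stripEmb g j ⟨u, huv'.1⟩) = j := apply_stripEmb _ _ _
      have gv : g (stripEmb g j ⟨v, huv'.2⟩) = j := apply_stripEmb _ _ _
      have pu : stripPos f (stripEmb f i ⟨u, huv.1⟩) = u := stripPos_stripEmb _ _ _
      have pv : stripPos f (stripEmb f i ⟨v, huv.2⟩) = v := stripPos_stripEmb _ _ _
      have pu' : stripPos g (stripEmb g j ⟨u, huv'.1⟩) = u := stripPos_stripEmb _ _ _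
      have pv' : stripPos g (stripEmb g j ⟨v, huv'.2⟩) = v := stripPos_stripEmb _ _ _
      apply h
      · exact ⟨fu, by rwa [pu]⟩
      · exact ⟨fv, by rwa [pv]⟩
      · exact ⟨gu, by rwa [pu']⟩
      · exact ⟨gv, by rwa [pv']⟩
      · rw [hposf _ fu (by rwa [pu]), hposg _ gu (by rwa [pu']), pu, pu']
      · rw [hposf _ fv (by rwa [pv]), hposg _ gv (by rwa [pv']), pv, pv']
    · rw [stripEntry_of_not_lt _ _ huv,
        stripEntry_of_not_lt _ _ (by rwa [← hsz u hu, ← hsz v hv])]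
  · rintro h x x' y y' ⟨hx, hxa⟩ ⟨hx', hxa'⟩ ⟨hy, hya⟩ ⟨hy', hya'⟩ hxy hxy'
    rw [hposf x hx hxa, hposg y hy hya] at hxy
    rw [hposf x' hx' hxa', hposg y' hy' hya'] at hxy'
    have h1 := Nat.count_injective (p := fun t => C i t = a) hxa hya hxy
    have h2 := Nat.count_injective (p := fun t => C i t = a) hxa' hya' hxy'
    rw [← stripEntry_stripPos R hx hx', h _ _ hxa hxa', h1, h2, stripEntry_stripPos S hy hy']

end StripLemmas

/-! ### Admissible transformations as a space of matrices -/

namespace Shape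

open Matrix

variable {m n : ℕ} (D : Shape m n)

/-- All pairs of (not necessarily unitary) block diagonal matrices whose diagonal blocks are equal
for marked blocks.  Its unitary elements are the admissible transformations, and its dimension
decreases when the division is refined. -/
noncomputable def blockSpace : Submodule ℂ (Matrix (Fin m) (Fin m) ℂ × Matrix (Fin n) (Fin n) ℂ) where
  carrier := {T | (∀ x x', D.row x ≠ D.row x' → T.1 x x' = 0) ∧
    (∀ y y', D.col y ≠ D.col y' → T.2 y y' = 0) ∧
    ∀ i j, (i, j) ∈ D.marked → stripEntry D.row T.1 i = stripEntry D.col T.2 j}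
  add_mem' := by
    rintro T T' ⟨h1, h2, h3⟩ ⟨h1', h2', h3'⟩
    refine ⟨fun x x' h => ?_, fun y y' h => ?_, fun i j h => ?_⟩
    · rw [Prod.fst_add, Matrix.add_apply, h1 x x' h, h1' x x' h, add_zero]
    · rw [Prod.snd_add, Matrix.add_apply, h2 y y' h, h2' y y' h, add_zero]
    · rw [Prod.fst_add, Prod.snd_add, stripEntry_add, stripEntry_add, h3 i j h, h3' i j h]
  zero_mem' := ⟨fun _ _ _ => rfl, fun _ _ _ => rfl, fun i j _ => by
    rw [Prod.fst_zero, Prod.snd_zero, stripEntry_zero, stripEntry_zero]⟩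
  smul_mem' := by
    rintro z T ⟨h1, h2, h3⟩
    refine ⟨fun x x' h => ?_, fun y y' h => ?_, fun i j h => ?_⟩
    · rw [Prod.smul_fst, Matrix.smul_apply, h1 x x' h, smul_zero]
    · rw [Prod.smul_snd, Matrix.smul_apply, h2 y y' h, smul_zero]
    · rw [Prod.smul_fst, Prod.smul_snd, stripEntry_smul, stripEntry_smul, h3 i j h]

variable {D}

theorem mem_blockSpace {R : Matrix (Fin m) (Fin m) ℂ} {S : Matrix (Fin n) (Fin n) ℂ} :
    (R, S) ∈ D.blockSpace ↔ (∀ x x', D.row x ≠ D.row x' → R x x' = 0) ∧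
      (∀ y y', D.col y ≠ D.col y' → S y y' = 0) ∧
      ∀ i j, (i, j) ∈ D.marked → stripEntry D.row R i = stripEntry D.col S j :=
  Iff.rfl

theorem isAdmissible_iff {R : unitaryGroup (Fin m) ℂ} {S : unitaryGroup (Fin n) ℂ} :
    D.IsAdmissible R S ↔
      ((R : Matrix (Fin m) (Fin m) ℂ), (S : Matrix (Fin n) (Fin n) ℂ)) ∈ D.blockSpace := by
  rw [mem_blockSpace]
  constructor
  · rintro ⟨h1, h2, h3⟩
    exact ⟨h1, h2, fun i j h => (natEntry_eq_iff (D.square i j h)).2 (h3 i j h)⟩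
  · rintro ⟨h1, h2, h3⟩
    exact ⟨h1, h2, fun i j h => (natEntry_eq_iff (D.square i j h)).1 (h3 i j h)⟩

/-- Whatever agrees on the two strips of each marked block agrees on linked strips. -/
theorem Linked.eq {α : Type*} {φ : Fin D.l ⊕ Fin D.r → α}
    (hφ : ∀ i j, (i, j) ∈ D.marked → φ (Sum.inl i) = φ (Sum.inr j)) {s t : Fin D.l ⊕ Fin D.r}
    (h : D.Linked s t) : φ s = φ t := by
  induction h with
  | rel _ _ h =>
    obtain ⟨i, j, h, rfl, rfl⟩ := h
    exact hφ i j h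
  | refl _ => rfl
  | symm _ _ _ ih => exact ih.symm
  | trans _ _ _ _ _ ih₁ ih₂ => exact ih₁.trans ih₂

variable (D) in
/-- The size of a horizontal or vertical strip. -/
def size : Fin D.l ⊕ Fin D.r → ℕ :=
  Sum.elim (stripSize D.row) (stripSize D.col)

theorem Linked.size_eq {s t : Fin D.l ⊕ Fin D.r} (h : D.Linked s t) : D.size s = D.size t :=
  h.eq D.square

theorem Linked.stripEntry_eq {R : Matrix (Fin m) (Fin m) ℂ} {S : Matrix (Fin n) (Fin n) ℂ}
    (hRS : (R, S) ∈ D.blockSpace) {s t : Fin D.l ⊕ Fin D.r} (h : D.Linked s t) :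
    Sum.elim (stripEntry D.row R) (stripEntry D.col S) s =
      Sum.elim (stripEntry D.row R) (stripEntry D.col S) t :=
  h.eq hRS.2.2

theorem cutting_left {k : ℕ} (p : Fin D.l) (q : Fin D.r) (c : ℕ → Fin (k + 1)) :
    D.cutting p q c (Sum.inl p) = c :=
  if_pos (Or.inl (.refl _))

theorem cutting_right {k : ℕ} (p : Fin D.l) (q : Fin D.r) (c : ℕ → Fin (k + 1)) :
    D.cutting p q c (Sum.inr q) = c :=
  if_pos (Or.inr (.refl _))

theorem mem_blockSpace_refine {k : ℕ} {p : Fin D.l} {q : Fin D.r} {c : ℕ → Fin (k + 1)}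
    {hc : Monotone c} {R : Matrix (Fin m) (Fin m) ℂ} {S : Matrix (Fin n) (Fin n) ℂ} :
    (R, S) ∈ (D.refine p q c hc).blockSpace ↔ (R, S) ∈ D.blockSpace ∧
      (∀ u v, c u ≠ c v → stripEntry D.row R p u v = 0) ∧
      ∀ u v, c u ≠ c v → stripEntry D.col S q u v = 0 := by
  have hmark : ∀ i j, (i, j) ∈ D.marked → ∀ a,
      (stripEntry (cutLabel D.row fun i => D.cutting p q c (Sum.inl i)) R
          (finProdFinEquiv (i, a)) =
        stripEntry (cutLabel D.col fun j => D.cutting p q c (Sum.inr j)) S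
          (finProdFinEquiv (j, a)) ↔
      ∀ u v, D.cutting p q c (Sum.inl i) u = a → D.cutting p q c (Sum.inl i) v = a →
        stripEntry D.row R i u v = stripEntry D.col S j u v) := fun i j h a =>
    stripEntry_cutLabel_eq_iff (c := D.cutting p q c (Sum.inl i)) rfl (D.cutting_eq_of_marked p q c h).symm
      (fun t _ => by rw [D.square i j h])
  constructor
  · rintro ⟨h1, h2, h3⟩
    obtain ⟨h1, h1'⟩ := (cut_diag_iff (f := D.row) (C := fun i => D.cutting p q c (Sum.inl i))).1 h1
    obtain ⟨h2, h2'⟩ := (cut_diag_iff (f := D.col) (C := fun j => D.cutting p q c (Sum.inr j))).1 h2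
    refine ⟨⟨h1, h2, fun i j h => ?_⟩, fun u v huv => h1' p u v ?_, fun u v huv => h2' q u v ?_⟩
    · ext u v
      by_cases huv : D.cutting p q c (Sum.inl i) u = D.cutting p q c (Sum.inl i) v
      · exact (hmark i j h _).1 (h3 _ _ ⟨i, j, _, h, rfl⟩) u v huv rfl
      · refine (h1' i u v huv).trans (h2' j u v ?_).symm
        rwa [← D.cutting_eq_of_marked p q c h]
    · rwa [cutting_left]
    · rwa [cutting_right]
  · rintro ⟨hD, hp, hq⟩
    have key : ∀ s u v, D.cutting p q c s u ≠ D.cutting p q c s v →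
        Sum.elim (stripEntry D.row R) (stripEntry D.col S) s u v = 0 := by
      intro s u v huv
      unfold cutting at huv
      split_ifs at huv with hs
      · rcases hs with hs | hs
        · rw [hs.stripEntry_eq hD]
          exact hp u v huv
        · rw [hs.stripEntry_eq hD]
          exact hq u v huv
      · exact absurd rfl huv
    refine ⟨cut_diag_iff.2 ⟨hD.1, fun i => key (Sum.inl i)⟩,
      cut_diag_iff.2 ⟨hD.2.1, fun j => key (Sum.inr j)⟩, ?_⟩
    rintro _ _ ⟨i, j, a, h, hb⟩
    obtain ⟨rfl, rfl⟩ := Prod.mk.inj hb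
    exact (hmark i j h a).2 fun u v _ _ => congrFun (congrFun (hD.2.2 i j h) u) v

theorem mem_blockSpace_refineMark {k : ℕ} {p : Fin D.l} {q : Fin D.r} {c : ℕ → Fin (k + 1)}
    {hc : Monotone c}
    {hcpq : ∀ t, c t ≠ Fin.last k → t < stripSize D.row p ∧ t < stripSize D.col q}
    {R : Matrix (Fin m) (Fin m) ℂ} {S : Matrix (Fin n) (Fin n) ℂ} :
    (R, S) ∈ (D.refineMark p q c hc hcpq).blockSpace ↔
      (R, S) ∈ (D.refine p q c hc).blockSpace ∧
      ∀ u v, c u = c v → c u ≠ Fin.last k →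
        stripEntry D.row R p u v = stripEntry D.col S q u v := by
  have hmark : ∀ a, a ≠ Fin.last k →
      (stripEntry (cutLabel D.row fun i => D.cutting p q c (Sum.inl i)) R
          (finProdFinEquiv (p, a)) =
        stripEntry (cutLabel D.col fun j => D.cutting p q c (Sum.inr j)) S
          (finProdFinEquiv (q, a)) ↔
      ∀ u v, c u = a → c v = a →
        stripEntry D.row R p u v = stripEntry D.col S q u v) := fun a ha =>
    stripEntry_cutLabel_eq_iff (c := c) (cutting_left p q c) (cutting_right p q c)
      (fun t ht => iff_of_true (hcpq t (by rwa [ht])).1 (hcpq t (by rwa [ht])).2)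
  constructor
  · rintro ⟨h1, h2, h3⟩
    exact ⟨⟨h1, h2, fun i j h => h3 i j (Or.inl h)⟩, fun u v huv hu =>
      (hmark _ hu).1 (h3 _ _ (Or.inr ⟨c u, hu, rfl⟩)) u v rfl huv.symm⟩
  · rintro ⟨⟨h1, h2, h3⟩, h4⟩
    refine ⟨h1, h2, ?_⟩
    rintro i' j' (h | ⟨a, ha, hb⟩)
    · exact h3 i' j' h
    · obtain ⟨rfl, rfl⟩ := Prod.mk.inj hb
      exact (hmark a ha).2 fun u v hu hv => h4 u v (hu.trans hv.symm) (hu ▸ ha)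

end Shape

/-! ### Admissible transformations with prescribed diagonal blocks -/

section Glue

open Matrix

variable {m l : ℕ}

/-- The block diagonal matrix whose diagonal blocks have the entries `W i u v`. -/
def glue (f : Fin m → Fin l) (W : Fin l → ℕ → ℕ → ℂ) : Matrix (Fin m) (Fin m) ℂ :=
  Matrix.of fun x x' => if f x = f x' then W (f x) (stripPos f x) (stripPos f x') else 0

theorem glue_of_ne (f : Fin m → Fin l) (W : Fin l → ℕ → ℕ → ℂ) {x x' : Fin m}
    (h : f x ≠ f x') : glue f W x x' = 0 :=
  if_neg h

theorem glue_of_eq (f : Fin m → Fin l) (W : Fin l → ℕ → ℕ → ℂ) {x x' : Fin m} {i : Fin l}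
    (h : f x = i) (h' : f x' = i) : glue f W x x' = W i (stripPos f x) (stripPos f x') := by
  subst h
  exact if_pos h'.symm

theorem stripEntry_glue (f : Fin m → Fin l) (W : Fin l → ℕ → ℕ → ℂ) (i : Fin l) (u v : ℕ) :
    stripEntry f (glue f W) i u v =
      if u < stripSize f i ∧ v < stripSize f i then W i u v else 0 := by
  split_ifs with h
  · have h1 := stripEntry_coe (glue f W) i ⟨u, h.1⟩ ⟨v, h.2⟩
    rw [glue_of_eq f W (apply_stripEmb f i ⟨u, h.1⟩) (apply_stripEmb f i ⟨v, h.2⟩),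
      stripPos_stripEmb f i ⟨u, h.1⟩, stripPos_stripEmb f i ⟨v, h.2⟩] at h1
    exact h1
  · exact stripEntry_of_not_lt _ _ h

theorem glue_mem_unitaryGroup (f : Fin m → Fin l) (W : Fin l → ℕ → ℕ → ℂ)
    (hW : ∀ i, ∀ u < stripSize f i, ∀ v < stripSize f i,
      ∑ t : Fin (stripSize f i), W i u t * star (W i v t) = if u = v then 1 else 0) :
    glue f W ∈ unitaryGroup (Fin m) ℂ := by
  rw [mem_unitaryGroup_iff]
  ext x y
  rw [Matrix.mul_apply, Matrix.one_apply, sum_stripEmb (f := f) (f x)]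
  · by_cases hxy : f x = f y
    · have h1 := hW (f x) _ (stripPos_lt_stripSize rfl) _ (stripPos_lt_stripSize hxy.symm)
      refine (Finset.sum_congr rfl fun t _ => ?_).trans (h1.trans (if_congr ?_ rfl rfl))
      · rw [star_apply, glue_of_eq f W rfl (apply_stripEmb f (f x) t),
          glue_of_eq f W hxy.symm (apply_stripEmb f (f x) t), stripPos_stripEmb]
      · exact ⟨eq_of_stripPos_eq hxy, congrArg _⟩
    · rw [if_neg (fun h => hxy (congrArg f h))]
      refine Finset.sum_eq_zero fun t _ => ?_
      rw [star_apply, glue_of_ne f W (x := y), star_zero, mul_zero]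
      exact fun h => hxy ((h.trans (apply_stripEmb f (f x) t)).symm)
  · intro z hz
    rw [glue_of_ne f W (Ne.symm hz), zero_mul]

theorem submatrix_stripEmb_mul {ι κ : Type*} {f : Fin m → Fin l} {R : Matrix (Fin m) (Fin m) ℂ}
    (h : ∀ x x', f x ≠ f x' → R x x' = 0) (A : Matrix (Fin m) ι ℂ) (e : κ → ι) (i : Fin l) :
    (R * A).submatrix (stripEmb f i) e =
      R.submatrix (stripEmb f i) (stripEmb f i) * A.submatrix (stripEmb f i) e := by
  ext u v
  refine sum_stripEmb (f := f) i fun x hx => ?_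
  have h1 : R (stripEmb f i u) x = 0 := h _ _ fun h' => hx (h'.symm.trans (apply_stripEmb f i u))
  exact mul_eq_zero_of_left h1 _

theorem mul_submatrix_stripEmb {ι κ : Type*} {f : Fin m → Fin l} {S : Matrix (Fin m) (Fin m) ℂ}
    (h : ∀ x x', f x ≠ f x' → S x x' = 0) (A : Matrix ι (Fin m) ℂ) (e : κ → ι) (i : Fin l) :
    (A * S).submatrix e (stripEmb f i) =
      A.submatrix e (stripEmb f i) * S.submatrix (stripEmb f i) (stripEmb f i) := by
  ext u v
  refine sum_stripEmb (f := f) i fun x hx => ?_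
  have h1 : S x (stripEmb f i v) = 0 := h _ _ fun h' => hx (h'.trans (apply_stripEmb f i v))
  exact mul_eq_zero_of_right _ h1

theorem submatrix_stripEmb_mem_unitaryGroup {f : Fin m → Fin l} {R : Matrix (Fin m) (Fin m) ℂ}
    (hR : R ∈ unitaryGroup (Fin m) ℂ) (h : ∀ x x', f x ≠ f x' → R x x' = 0) (i : Fin l) :
    R.submatrix (stripEmb f i) (stripEmb f i) ∈ unitaryGroup _ ℂ := by
  rw [mem_unitaryGroup_iff]
  refine (submatrix_stripEmb_mul h (star R) (stripEmb f i) i).symm.trans ?_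
  rw [mem_unitaryGroup_iff.1 hR]
  exact Matrix.submatrix_one _ (stripEmb f i).injective

theorem mul_eq_zero_of_ne {f : Fin m → Fin l} {R R' : Matrix (Fin m) (Fin m) ℂ}
    (h : ∀ x x', f x ≠ f x' → R x x' = 0) (h' : ∀ x x', f x ≠ f x' → R' x x' = 0)
    {x x' : Fin m} (hx : f x ≠ f x') : (R * R') x x' = 0 := by
  rw [Matrix.mul_apply]
  refine Finset.sum_eq_zero fun y _ => ?_
  by_cases hy : f x = f y
  · rw [h' y x' (hy ▸ hx), mul_zero]
  · rw [h x y hy, zero_mul]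

end Glue

namespace Shape

open Matrix

variable {m n : ℕ} {D : Shape m n}

theorem glue_mem_blockSpace {W : Fin D.l ⊕ Fin D.r → ℕ → ℕ → ℂ}
    (hW : ∀ i j, (i, j) ∈ D.marked → W (Sum.inl i) = W (Sum.inr j)) :
    (glue D.row (fun i => W (Sum.inl i)), glue D.col (fun j => W (Sum.inr j))) ∈ D.blockSpace := by
  refine ⟨fun x x' h => if_neg h, fun y y' h => if_neg h, fun i j h => ?_⟩
  ext u v
  rw [stripEntry_glue, stripEntry_glue, D.square i j h, hW i j h]

theorem linked_congr {i : Fin D.l} {j : Fin D.r} (h : (i, j) ∈ D.marked)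
    (t : Fin D.l ⊕ Fin D.r) : D.Linked (Sum.inl i) t ↔ D.Linked (Sum.inr j) t := by
  have h1 : D.Linked (Sum.inl i) (Sum.inr j) := .rel _ _ ⟨i, j, h, rfl, rfl⟩
  exact ⟨fun h => (h1.symm).trans _ _ _ h, fun h => h1.trans _ _ _ h⟩

/-- The entries of a unitary matrix satisfy the orthogonality relations. -/
theorem sum_natEntry_mul_star {s s' : ℕ} (hs : s' = s) {U : Matrix (Fin s) (Fin s) ℂ}
    (hU : U ∈ unitaryGroup (Fin s) ℂ) (u : ℕ) (hu : u < s') (v : ℕ) (hv : v < s') :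
    ∑ t : Fin s', natEntry U u t * star (natEntry U v t) = if u = v then 1 else 0 := by
  subst hs
  have h := congrFun (congrFun (mem_unitaryGroup_iff.1 hU) ⟨u, hu⟩) ⟨v, hv⟩
  rw [Matrix.mul_apply, Matrix.one_apply] at h
  simp only [Fin.mk.injEq] at h
  rw [← h]
  refine Finset.sum_congr rfl fun t _ => ?_
  have h1 := natEntry_coe U ⟨u, hu⟩ t
  have h2 := natEntry_coe U ⟨v, hv⟩ t
  rw [star_apply, ← h1, ← h2]

/-- Unitary matrices prescribed on the strips `p` and `q` extend to an admissible transformation: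
repeat them on the linked strips and put identity matrices elsewhere. -/
theorem exists_isAdmissible {p : Fin D.l} {q : Fin D.r}
    {U : Matrix (Fin (stripSize D.row p)) (Fin (stripSize D.row p)) ℂ}
    (hU : U ∈ unitaryGroup _ ℂ)
    {V : Matrix (Fin (stripSize D.col q)) (Fin (stripSize D.col q)) ℂ}
    (hV : V ∈ unitaryGroup _ ℂ)
    (h : D.Linked (Sum.inl p) (Sum.inr q) → natEntry U = natEntry V) :
    ∃ R S, D.IsAdmissible R S ∧ D.rowBlock R p = U ∧ D.colBlock S q = V := by
  classical
  let W : Fin D.l ⊕ Fin D.r → ℕ → ℕ → ℂ := fun s =>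
    if D.Linked s (Sum.inl p) then natEntry U
    else if D.Linked s (Sum.inr q) then natEntry V
    else fun u v => if u = v then 1 else 0
  have hWU : ∀ s, ∀ u < D.size s, ∀ v < D.size s,
      ∑ t : Fin (D.size s), W s u t * star (W s v t) = if u = v then 1 else 0 := by
    intro s u hu v hv
    by_cases h1 : D.Linked s (Sum.inl p)
    · simp only [W, if_pos h1]
      exact sum_natEntry_mul_star h1.size_eq hU u hu v hv
    by_cases h2 : D.Linked s (Sum.inr q)
    · simp only [W, if_neg h1, if_pos h2]
      exact sum_natEntry_mul_star h2.size_eq hV u hu v hv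
    · simp only [W, if_neg h1, if_neg h2]
      rw [Finset.sum_eq_single ⟨u, hu⟩]
      · simp [eq_comm]
      · intro t _ ht
        rw [if_neg (fun h => ht (Fin.ext h.symm)), zero_mul]
      · simp
  have hWm : ∀ i j, (i, j) ∈ D.marked → W (Sum.inl i) = W (Sum.inr j) := fun i j hij => by
    simp only [W, linked_congr hij]
  refine ⟨⟨_, glue_mem_unitaryGroup D.row _ fun i => hWU (Sum.inl i)⟩,
    ⟨_, glue_mem_unitaryGroup D.col _ fun j => hWU (Sum.inr j)⟩,
    isAdmissible_iff.2 (glue_mem_blockSpace hWm), ?_, ?_⟩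
  · have hWp : W (Sum.inl p) = natEntry U := if_pos (.refl _)
    ext u v
    refine (stripEntry_coe (glue D.row fun i => W (Sum.inl i)) p u v).symm.trans ?_
    rw [stripEntry_glue, if_pos ⟨u.2, v.2⟩, hWp, natEntry_coe]
  · have hWq : W (Sum.inr q) = natEntry V := by
      simp only [W]
      split_ifs with h1 h2
      · exact h h1.symm
      · rfl
      · exact absurd (.refl _) h2
    ext u v
    refine (stripEntry_coe (glue D.col fun j => W (Sum.inr j)) q u v).symm.trans ?_
    rw [stripEntry_glue, if_pos ⟨u.2, v.2⟩, hWq, natEntry_coe]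

/-! ### The action of admissible transformations on blocks -/

theorem rowBlock_mem {R : unitaryGroup (Fin m) ℂ} {S : unitaryGroup (Fin n) ℂ}
    (h : D.IsAdmissible R S) (i : Fin D.l) : D.rowBlock R i ∈ unitaryGroup _ ℂ :=
  submatrix_stripEmb_mem_unitaryGroup R.2 h.row_diag i

theorem colBlock_mem {R : unitaryGroup (Fin m) ℂ} {S : unitaryGroup (Fin n) ℂ}
    (h : D.IsAdmissible R S) (j : Fin D.r) : D.colBlock S j ∈ unitaryGroup _ ℂ :=
  submatrix_stripEmb_mem_unitaryGroup S.2 h.col_diag j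

theorem mat_eq_iff {R : unitaryGroup (Fin m) ℂ} {S : unitaryGroup (Fin n) ℂ}
    {A B : Matrix (Fin m) (Fin n) ℂ} :
    B = ((R⁻¹ : unitaryGroup (Fin m) ℂ) : Matrix (Fin m) (Fin m) ℂ) * A * (S : Matrix (Fin n) (Fin n) ℂ) ↔
      (R : Matrix (Fin m) (Fin m) ℂ) * B = A * (S : Matrix (Fin n) (Fin n) ℂ) := by
  have h1 : (R : Matrix (Fin m) (Fin m) ℂ) * ((R⁻¹ : unitaryGroup (Fin m) ℂ) :
    Matrix (Fin m) (Fin m) ℂ) = 1 := congrArg Subtype.val (mul_inv_cancel R)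
  have h2 : ((R⁻¹ : unitaryGroup (Fin m) ℂ) : Matrix (Fin m) (Fin m) ℂ) *
    (R : Matrix (Fin m) (Fin m) ℂ) = 1 := congrArg Subtype.val (inv_mul_cancel R)
  constructor
  · rintro rfl
    rw [← Matrix.mul_assoc, ← Matrix.mul_assoc, h1, Matrix.one_mul]
  · intro h
    rw [Matrix.mul_assoc, ← h, ← Matrix.mul_assoc, h2, Matrix.one_mul]

theorem block_eq {R : unitaryGroup (Fin m) ℂ} {S : unitaryGroup (Fin n) ℂ}
    (h : D.IsAdmissible R S) {A B : Matrix (Fin m) (Fin n) ℂ}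
    (hB : B = ((R⁻¹ : unitaryGroup (Fin m) ℂ) : Matrix (Fin m) (Fin m) ℂ) *
      A * (S : Matrix (Fin n) (Fin n) ℂ))
    (i : Fin D.l) (j : Fin D.r) :
    D.block A i j * D.colBlock S j = D.rowBlock R i * D.block B i j := by
  have h1 := mul_submatrix_stripEmb h.col_diag A (stripEmb D.row i) j
  have h2 := submatrix_stripEmb_mul h.row_diag B (stripEmb D.col j) i
  exact h1.symm.trans ((congrArg (D.block · i j) (mat_eq_iff.1 hB)).symm.trans h2)

theorem isAdmissible_one : D.IsAdmissible 1 1 := by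
  refine isAdmissible_iff.2 ⟨fun x x' h => ?_, fun y y' h => ?_, fun i j h => ?_⟩
  · exact Matrix.one_apply_ne (fun h' => h (congrArg _ h'))
  · exact Matrix.one_apply_ne (fun h' => h (congrArg _ h'))
  · refine (natEntry_eq_iff (D.square i j h)).2 ?_
    ext u v
    simp [Matrix.one_apply, Fin.ext_iff]

theorem IsAdmissible.mul {R R' : unitaryGroup (Fin m) ℂ} {S S' : unitaryGroup (Fin n) ℂ}
    (h : D.IsAdmissible R S) (h' : D.IsAdmissible R' S') : D.IsAdmissible (R * R') (S * S') where
  row_diag _ _ hx := mul_eq_zero_of_ne h.row_diag h'.row_diag hx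
  col_diag _ _ hy := mul_eq_zero_of_ne h.col_diag h'.col_diag hy
  marked_eq i j hij := by
    have h1 := submatrix_stripEmb_mul h.row_diag (R' : Matrix (Fin m) (Fin m) ℂ) (stripEmb D.row i) i
    have h2 := submatrix_stripEmb_mul h.col_diag (S' : Matrix (Fin n) (Fin n) ℂ) (stripEmb D.col j) j
    refine h1.trans (Eq.trans ?_ (congrArg (fun M : Matrix _ _ ℂ =>
      M.submatrix (Fin.cast (D.square i j hij)) (Fin.cast (D.square i j hij))) h2).symm)
    refine (congrArg₂ (· * ·) (h.marked_eq i j hij) (h'.marked_eq i j hij)).trans ?_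
    exact Matrix.submatrix_mul_equiv _ _ _ (finCongr (D.square i j hij)) _

theorem IsAdmissible.inv {R : unitaryGroup (Fin m) ℂ} {S : unitaryGroup (Fin n) ℂ}
    (h : D.IsAdmissible R S) : D.IsAdmissible R⁻¹ S⁻¹ where
  row_diag x x' hx := by
    exact (congrArg star (h.row_diag _ _ (Ne.symm hx))).trans (star_zero ℂ)
  col_diag y y' hy := by
    exact (congrArg star (h.col_diag _ _ (Ne.symm hy))).trans (star_zero ℂ)
  marked_eq i j hij := by
    ext u v
    have := congrFun (congrFun (h.marked_eq i j hij) v) u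
    exact congrArg star this

end Shape

/-! ### Equivalence of marked block matrices -/

namespace MarkedBlockMatrix

open Matrix Shape

variable {m n : ℕ} {A B C : MarkedBlockMatrix m n}

theorem equivalent_iff {D : Shape m n} {M N : Matrix (Fin m) (Fin n) ℂ} :
    Equivalent ⟨D, M⟩ ⟨D, N⟩ ↔ ∃ R S, D.IsAdmissible R S ∧
      N = ((R⁻¹ : unitaryGroup (Fin m) ℂ) : Matrix (Fin m) (Fin m) ℂ) * M *
        (S : Matrix (Fin n) (Fin n) ℂ) :=
  ⟨fun h => h.2, fun h => ⟨rfl, h⟩⟩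

theorem Equivalent.refl (A : MarkedBlockMatrix m n) : A.Equivalent A :=
  ⟨rfl, 1, 1, isAdmissible_one, by simp⟩

theorem Equivalent.symm (h : A.Equivalent B) : B.Equivalent A := by
  obtain ⟨D, M⟩ := A
  obtain ⟨D', N⟩ := B
  obtain ⟨hD, R, S, hRS, hN⟩ := h
  obtain rfl : D' = D := hD
  refine ⟨rfl, R⁻¹, S⁻¹, hRS.inv, mat_eq_iff.2 ?_⟩
  have hN' : N = _ := hN
  have h1 : (S : Matrix (Fin n) (Fin n) ℂ) * ((S⁻¹ : unitaryGroup (Fin n) ℂ) :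
    Matrix (Fin n) (Fin n) ℂ) = 1 := congrArg Subtype.val (mul_inv_cancel S)
  change _ * M = N * _
  rw [hN', Matrix.mul_assoc, h1, Matrix.mul_one]

theorem Equivalent.trans (h : A.Equivalent B) (h' : B.Equivalent C) : A.Equivalent C := by
  obtain ⟨D, M⟩ := A
  obtain ⟨D', N⟩ := B
  obtain ⟨hD, R, S, hRS, hN⟩ := h
  obtain rfl : D' = D := hD
  obtain ⟨hC, R', S', hRS', hP⟩ := h'
  refine ⟨hC, R * R', S * S', hRS.mul hRS', mat_eq_iff.2 ?_⟩
  have h1 : (R : Matrix (Fin m) (Fin m) ℂ) * N = M * (S : Matrix (Fin n) (Fin n) ℂ) :=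
    mat_eq_iff.1 hN
  have h2 : (R' : Matrix (Fin m) (Fin m) ℂ) * C.mat = N * (S' : Matrix (Fin n) (Fin n) ℂ) :=
    mat_eq_iff.1 hP
  change (R : Matrix (Fin m) (Fin m) ℂ) * (R' : Matrix (Fin m) (Fin m) ℂ) * C.mat = M * ((S : Matrix (Fin n) (Fin n) ℂ) *
    (S' : Matrix (Fin n) (Fin n) ℂ))
  rw [Matrix.mul_assoc, h2, ← Matrix.mul_assoc, h1, Matrix.mul_assoc]

/-- Equivalence for a division with fewer transformations implies equivalence for one with more. -/
theorem Equivalent.mono {D D' : Shape m n} (hD : D'.blockSpace ≤ D.blockSpace)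
    {M N : Matrix (Fin m) (Fin n) ℂ} (h : Equivalent ⟨D', M⟩ ⟨D', N⟩) :
    Equivalent ⟨D, M⟩ ⟨D, N⟩ := by
  obtain ⟨-, R, S, hRS, hN⟩ := h
  exact ⟨rfl, R, S, isAdmissible_iff.2 (hD (isAdmissible_iff.1 hRS)), hN⟩

theorem changes_iff {D : Shape m n} {M : Matrix (Fin m) (Fin n) ℂ} {i : Fin D.l} {j : Fin D.r} :
    Changes ⟨D, M⟩ i j ↔ ∃ N, Equivalent ⟨D, M⟩ ⟨D, N⟩ ∧ D.block N i j ≠ D.block M i j := by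
  constructor
  · rintro ⟨R, S, hRS, h⟩
    exact ⟨_, equivalent_iff.2 ⟨R, S, hRS, rfl⟩, h⟩
  · rintro ⟨N, hN, h⟩
    obtain ⟨R, S, hRS, rfl⟩ := equivalent_iff.1 hN
    exact ⟨R, S, hRS, h⟩

theorem Equivalent.changes {D : Shape m n} {M N : Matrix (Fin m) (Fin n) ℂ}
    (h : Equivalent ⟨D, M⟩ ⟨D, N⟩) {i : Fin D.l} {j : Fin D.r} (hM : Changes ⟨D, M⟩ i j) :
    Changes ⟨D, N⟩ i j := by
  obtain ⟨P, hP, hne⟩ := changes_iff.1 hM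
  by_cases hPN : D.block P i j = D.block N i j
  · exact changes_iff.2 ⟨M, h.symm, fun h' => hne (hPN.trans h'.symm)⟩
  · exact changes_iff.2 ⟨P, h.symm.trans hP, hPN⟩

theorem IsFinal.of_equivalent (h : A.Equivalent B) (hA : A.IsFinal) : B.IsFinal := by
  obtain ⟨D, M⟩ := A
  obtain ⟨D', N⟩ := B
  obtain rfl : D' = D := h.1
  exact fun i j hB => hA i j (h.symm.changes hB)

theorem IsFinal.mat_eq (h : A.Equivalent B) (hA : A.IsFinal) : B.mat = A.mat := by
  obtain ⟨D, M⟩ := A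
  obtain ⟨D', N⟩ := B
  obtain rfl : D' = D := h.1
  ext x y
  by_contra hne
  refine hA (D'.row x) (D'.col y) (changes_iff.2 ⟨N, h, fun h' => hne ?_⟩)
  have h1 := congrFun (congrFun h' ⟨_, stripPos_lt_stripSize rfl⟩) ⟨_, stripPos_lt_stripSize rfl⟩
  change N (stripEmb D'.row _ _) (stripEmb D'.col _ _) =
    M (stripEmb D'.row _ _) (stripEmb D'.col _ _) at h1
  rwa [stripEmb_stripPos rfl, stripEmb_stripPos rfl] at h1

theorem IsFirstChanging.unique {p p' : Fin A.shape.l} {q q' : Fin A.shape.r}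
    (h : A.IsFirstChanging p q) (h' : A.IsFirstChanging p' q') : p = p' ∧ q = q' := by
  have h1 := h.2 p' q' h'.1
  have h2 := h'.2 p q h.1
  rcases h1 with ⟨h1, h1'⟩ | h1 <;> rcases h2 with ⟨h2, h2'⟩ | h2
  · exact ⟨h1, le_antisymm h1' h2'⟩
  · exact absurd h1.symm h2.ne'
  · exact absurd h2.symm h1.ne'
  · exact absurd h1 h2.asymm

theorem Equivalent.isFirstChanging {D : Shape m n} {M N : Matrix (Fin m) (Fin n) ℂ}
    (h : Equivalent ⟨D, M⟩ ⟨D, N⟩) {p : Fin D.l} {q : Fin D.r}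
    (hM : IsFirstChanging ⟨D, M⟩ p q) : IsFirstChanging ⟨D, N⟩ p q :=
  ⟨h.changes hM.1, fun i j hij => hM.2 i j (h.symm.changes hij)⟩

theorem exists_isFirstChanging (hA : ¬ A.IsFinal) : ∃ p q, A.IsFirstChanging p q := by
  unfold IsFinal at hA
  push Not at hA
  obtain ⟨i, j, hij⟩ := hA
  obtain ⟨⟨p, q⟩, hpq, hmin⟩ := Set.exists_min_image
    {b : Fin A.shape.l × Fin A.shape.r | A.Changes b.1 b.2}
    (fun b => toLex (OrderDual.toDual b.1, b.2)) (Set.toFinite _) ⟨(i, j), hij⟩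
  refine ⟨p, q, hpq, fun i j hij => ?_⟩
  rcases Prod.Lex.toLex_le_toLex.1 (hmin (i, j) hij) with h | ⟨h, h'⟩
  · exact Or.inr (OrderDual.toDual_lt_toDual.1 h)
  · exact Or.inl ⟨OrderDual.toDual.injective h, h'⟩

/-! ### One step of the reduction -/

theorem rowBlock_eq_of_linked {D : Shape m n} {R : unitaryGroup (Fin m) ℂ}
    {S : unitaryGroup (Fin n) ℂ} (h : D.IsAdmissible R S) {p : Fin D.l} {q : Fin D.r}
    (hpq : D.Linked (Sum.inl p) (Sum.inr q)) (hs : stripSize D.row p = stripSize D.col q) :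
    D.rowBlock R p = (D.colBlock S q).submatrix (Fin.cast hs) (Fin.cast hs) :=
  (natEntry_eq_iff hs).1 (hpq.stripEntry_eq (isAdmissible_iff.1 h))

theorem submatrix_cast_mul {s t : ℕ} {ι : Type*} (h : s = t) (X : Matrix ι (Fin t) ℂ)
    (Y : Matrix (Fin t) (Fin t) ℂ) : (X * Y).submatrix id (Fin.cast h) =
      X.submatrix id (Fin.cast h) * Y.submatrix (Fin.cast h) (Fin.cast h) := by
  subst h
  rfl

/-- On linked strips admissible transformations act by unitary similarity. -/
theorem block_eq_of_linked {D : Shape m n} {M N : Matrix (Fin m) (Fin n) ℂ}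
    {R : unitaryGroup (Fin m) ℂ} {S : unitaryGroup (Fin n) ℂ} (h : D.IsAdmissible R S)
    (hN : N = ((R⁻¹ : unitaryGroup (Fin m) ℂ) : Matrix (Fin m) (Fin m) ℂ) * M *
      (S : Matrix (Fin n) (Fin n) ℂ)) {p : Fin D.l} {q : Fin D.r}
    (hpq : D.Linked (Sum.inl p) (Sum.inr q)) (hs : stripSize D.row p = stripSize D.col q) :
    (D.block M p q).submatrix id (Fin.cast hs) * D.rowBlock R p =
      D.rowBlock R p * (D.block N p q).submatrix id (Fin.cast hs) := by
  have h1 := congrArg (fun X : Matrix _ _ ℂ => X.submatrix id (Fin.cast hs)) (block_eq h hN p q)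
  rw [rowBlock_eq_of_linked h hpq hs]
  rw [rowBlock_eq_of_linked h hpq hs] at h1
  exact (submatrix_cast_mul hs _ _).symm.trans h1

theorem derived_iff {D D' : Shape m n} {M M' : Matrix (Fin m) (Fin n) ℂ} :
    Derived ⟨D, M⟩ ⟨D', M'⟩ ↔ ∃ (p : Fin D.l) (q : Fin D.r), IsFirstChanging ⟨D, M⟩ p q ∧
      Equivalent ⟨D, M⟩ ⟨D, M'⟩ ∧
      ((D.Linked (Sum.inl p) (Sum.inr q) ∧
          ∃ (h : stripSize D.row p = stripSize D.col q) (k : ℕ) (c : ℕ → Fin (k + 1))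
            (lam : Fin (k + 1) → ℂ)
            (hF : IsTriangularForm ((D.block M' p q).submatrix id (Fin.cast h)) c lam),
            D' = D.refine p q c hF.mono) ∨
        (¬ D.Linked (Sum.inl p) (Sum.inr q) ∧
          ∃ (k : ℕ) (c : ℕ → Fin (k + 1)) (a : Fin (k + 1) → ℝ)
            (hF : IsDiagonalForm (D.block M' p q) c a),
            D' = D.refineMark p q c hF.mono hF.lt_size)) :=
  Iff.rfl

/-- The derived matrices of equivalent matrices are equivalent. -/
theorem Derived.equivalent {A' B' : MarkedBlockMatrix m n} (hAB : A.Equivalent B)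
    (hA : A.Derived A') (hB : B.Derived B') : A'.Equivalent B' := by
  obtain ⟨D, M⟩ := A
  obtain ⟨D₀, N⟩ := B
  obtain rfl : D₀ = D := hAB.1
  obtain ⟨DA, M'⟩ := A'
  obtain ⟨DB, N'⟩ := B'
  obtain ⟨p, q, hpq, hM, hA⟩ := derived_iff.1 hA
  obtain ⟨p', q', hpq', hN, hB⟩ := derived_iff.1 hB
  obtain ⟨rfl, rfl⟩ := (hAB.isFirstChanging hpq).unique hpq'
  obtain ⟨R, S, hRS, hN'⟩ := equivalent_iff.1 ((hM.symm.trans hAB).trans hN)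
  have hRS' := isAdmissible_iff.1 hRS
  rcases hA with ⟨hl, hs, k, c, lam, hF, rfl⟩ | ⟨hl, k, c, a, hF, rfl⟩
  · rcases hB with ⟨_, _, k', c', lam', hF', rfl⟩ | ⟨hl', -⟩
    · obtain ⟨rfl, hc, -, hU⟩ := hF.unique hF' (rowBlock_mem hRS p)
        (block_eq_of_linked hRS hN' hl hs)
      obtain rfl := eq_of_heq hc
      have hR : ∀ u v, c u ≠ c v → stripEntry D₀.row (R : Matrix (Fin m) (Fin m) ℂ) p u v = 0 := by
        intro u v huv
        by_cases hlt : u < stripSize D₀.row p ∧ v < stripSize D₀.row p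
        · exact (stripEntry_coe _ p ⟨u, hlt.1⟩ ⟨v, hlt.2⟩).trans (hU _ _ huv)
        · exact stripEntry_of_not_lt _ _ hlt
      refine ⟨rfl, R, S, isAdmissible_iff.2 ((mem_blockSpace_refine (hc := hF.mono)).2
        ⟨hRS', hR, ?_⟩), hN'⟩
      have h1 : stripEntry D₀.row (R : Matrix (Fin m) (Fin m) ℂ) p =
        stripEntry D₀.col (S : Matrix (Fin n) (Fin n) ℂ) q := hl.stripEntry_eq hRS'
      rwa [← h1]
    · exact absurd hl hl'
  · rcases hB with ⟨hl', -⟩ | ⟨_, k', c', a', hF', rfl⟩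
    · exact absurd hl' hl
    · obtain ⟨rfl, hc, -, hU, hV, hUV⟩ := hF.unique hF' (rowBlock_mem hRS p) (colBlock_mem hRS q)
        (block_eq hRS hN' p q)
      obtain rfl := eq_of_heq hc
      refine ⟨rfl, R, S, isAdmissible_iff.2
        ((mem_blockSpace_refineMark (hc := hF.mono) (hcpq := hF.lt_size)).2
        ⟨(mem_blockSpace_refine (hc := hF.mono)).2 ⟨hRS', fun u v huv => ?_, fun u v huv => ?_⟩,
          fun u v huv hu => ?_⟩), hN'⟩
      · by_cases hlt : u < stripSize D₀.row p ∧ v < stripSize D₀.row p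
        · exact (stripEntry_coe _ p ⟨u, hlt.1⟩ ⟨v, hlt.2⟩).trans (hU _ _ huv)
        · exact stripEntry_of_not_lt _ _ hlt
      · by_cases hlt : u < stripSize D₀.col q ∧ v < stripSize D₀.col q
        · exact (stripEntry_coe _ q ⟨u, hlt.1⟩ ⟨v, hlt.2⟩).trans (hV _ _ huv)
        · exact stripEntry_of_not_lt _ _ hlt
      · have h1 := hF.lt_size u hu
        have h2 := hF.lt_size v (huv ▸ hu)
        exact (stripEntry_coe _ p ⟨u, h1.1⟩ ⟨v, h2.1⟩).trans
          ((hUV ⟨u, h1.1⟩ ⟨v, h2.1⟩ ⟨u, h1.2⟩ ⟨v, h2.2⟩ rfl rfl huv hu).trans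
            (stripEntry_coe _ q ⟨u, h1.2⟩ ⟨v, h2.2⟩).symm)

theorem submatrix_cast_mem_unitaryGroup {s t : ℕ} (h : s = t) {U : Matrix (Fin t) (Fin t) ℂ}
    (hU : U ∈ unitaryGroup (Fin t) ℂ) :
    U.submatrix (Fin.cast h) (Fin.cast h) ∈ unitaryGroup (Fin s) ℂ := by
  subst h
  exact hU

/-- Cancelling a unitary factor. -/
theorem eq_conjTranspose_mul {s : ℕ} {ι : Type*} {U : Matrix (Fin s) (Fin s) ℂ}
    (hU : U ∈ unitaryGroup (Fin s) ℂ) {X Y : Matrix (Fin s) ι ℂ} (h : X = U * Y) :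
    Y = Uᴴ * X := by
  have h1 : Uᴴ * U = 1 := mem_unitaryGroup_iff'.1 hU
  rw [h, ← Matrix.mul_assoc, h1, Matrix.one_mul]

/-- The reduction can be continued as long as some block changes. -/
theorem exists_derived (hA : ¬ A.IsFinal) : ∃ A', A.Derived A' := by
  obtain ⟨p, q, hpq⟩ := exists_isFirstChanging hA
  obtain ⟨D, M⟩ := A
  by_cases hl : D.Linked (Sum.inl p) (Sum.inr q)
  · have hs : stripSize D.row p = stripSize D.col q := hl.size_eq
    have hpos : 0 < stripSize D.row p := by
      by_contra h0
      obtain ⟨R, S, -, hne⟩ := hpq.1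
      refine hne ?_
      ext u v
      exact absurd u.2 (by change ¬ (u : ℕ) < stripSize D.row p; omega)
    obtain ⟨U, hU, k, c, lam, hF⟩ :=
      exists_isTriangularForm hpos ((D.block M p q).submatrix id (Fin.cast hs))
    obtain ⟨R, S, hRS, hR, -⟩ := exists_isAdmissible (D := D) hU
      (submatrix_cast_mem_unitaryGroup hs.symm hU) (fun _ => ((natEntry_eq_iff hs.symm).2 rfl).symm)
    set N := ((R⁻¹ : unitaryGroup (Fin m) ℂ) : Matrix (Fin m) (Fin m) ℂ) * M *
      (S : Matrix (Fin n) (Fin n) ℂ) with hN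
    have h1 := block_eq_of_linked hRS hN hl hs
    rw [hR] at h1
    rw [Matrix.mul_assoc, ← eq_conjTranspose_mul hU h1] at hF
    exact ⟨⟨D.refine p q c hF.mono, N⟩, p, q, hpq, ⟨rfl, R, S, hRS, hN⟩,
      Or.inl ⟨hl, hs, k, c, lam, hF, rfl⟩⟩
  · obtain ⟨U, hU, V, hV, k, c, a, hF⟩ := exists_isDiagonalForm (D.block M p q)
    obtain ⟨R, S, hRS, hR, hS⟩ := exists_isAdmissible (D := D) hU hV (fun h => absurd h hl)
    set N := ((R⁻¹ : unitaryGroup (Fin m) ℂ) : Matrix (Fin m) (Fin m) ℂ) * M *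
      (S : Matrix (Fin n) (Fin n) ℂ) with hN
    have h1 := block_eq hRS hN p q
    rw [hR, hS] at h1
    rw [Matrix.mul_assoc, ← eq_conjTranspose_mul hU h1] at hF
    exact ⟨⟨D.refineMark p q c hF.mono hF.lt_size, N⟩, p, q, hpq, ⟨rfl, R, S, hRS, hN⟩,
      Or.inr ⟨hl, k, c, a, hF, rfl⟩⟩

/-- A derived matrix admits strictly fewer transformations: otherwise the first changing block would
not change, or all transformations of a strip that is really cut would be block diagonal. -/
theorem Derived.blockSpace_lt {A' : MarkedBlockMatrix m n} (h : A.Derived A') :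
    A'.shape.blockSpace < A.shape.blockSpace := by
  obtain ⟨D, M⟩ := A
  obtain ⟨D', M'⟩ := A'
  obtain ⟨p, q, hpq, hM, h⟩ := derived_iff.1 h
  obtain ⟨N, hMN, hne⟩ := changes_iff.1 (hM.changes hpq.1)
  obtain ⟨R, S, hRS, hN⟩ := equivalent_iff.1 hMN
  change D'.blockSpace < D.blockSpace
  have hRS' := isAdmissible_iff.1 hRS
  rcases h with ⟨hl, hs, k, c, lam, hF, rfl⟩ | ⟨hl, k, c, a, hF, rfl⟩
  · refine lt_of_le_not_ge (fun T hT => (mem_blockSpace_refine.1 hT).1) fun hle => ?_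
    obtain ⟨x, hx⟩ := hF.nonempty 0
    obtain ⟨y, hy⟩ := hF.nonempty (Fin.last k)
    rcases Nat.eq_zero_or_pos k with rfl | hk
    · -- The block is a scalar matrix, hence invariant under similarity.
      have h0 : ∀ i : Fin (0 + 1), i = 0 := fun i => Subsingleton.elim (α := Fin 1) i 0
      have hFs : (D.block M' p q).submatrix id (Fin.cast hs) = Matrix.diagonal fun _ => lam 0 := by
        ext u v
        rw [hF.diag u v ((h0 _).trans (h0 _).symm), Matrix.diagonal_apply, h0 (c u)]
      have h1 := block_eq_of_linked hRS hN hl hs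
      have h2 : (D.block N p q).submatrix id (Fin.cast hs) =
          (D.block M' p q).submatrix id (Fin.cast hs) := by
        rw [eq_conjTranspose_mul (rowBlock_mem hRS p) h1]
        refine (eq_conjTranspose_mul (rowBlock_mem hRS p) ?_).symm
        rw [hFs]
        ext u v
        rw [Matrix.diagonal_mul, Matrix.mul_diagonal, mul_comm]
      refine hne ?_
      ext u v
      exact congrFun (congrFun h2 u) (Fin.cast hs.symm v)
    · -- A matrix unit in a position outside the diagonal blocks of the cut strip.
      classical
      let W : Fin D.l ⊕ Fin D.r → ℕ → ℕ → ℂ := fun s u v =>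
        if D.Linked s (Sum.inl p) ∧ u = x ∧ v = y then 1 else 0
      have h1 : (glue D.row (fun i => W (Sum.inl i)), glue D.col (fun j => W (Sum.inr j))) ∈
          D.blockSpace := glue_mem_blockSpace fun i j hij => by
        simp only [W, linked_congr hij]
      have hxy : c x ≠ c y := by
        rw [hx, hy]
        intro h
        have := congrArg Fin.val h
        simp at this
        omega
      have h2 := (mem_blockSpace_refine.1 (hle h1)).2.1 x y hxy
      rw [stripEntry_glue, if_pos ⟨x.2, y.2⟩] at h2
      exact one_ne_zero ((if_pos ⟨.refl _, rfl, rfl⟩).symm.trans h2)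
  · refine lt_of_le_not_ge (fun T hT =>
      (mem_blockSpace_refine.1 (mem_blockSpace_refineMark.1 hT).1).1) fun hle => ?_
    obtain ⟨h1, h2⟩ := mem_blockSpace_refineMark.1 (hle hRS')
    obtain ⟨-, h3, h4⟩ := mem_blockSpace_refine.1 h1
    have h5 : D.block M' p q * D.colBlock S q = D.rowBlock R p * D.block M' p q := by
      refine hF.mul_eq_mul (fun u v huv => ?_) (fun u v huv => ?_) fun u v u' v' hu hv huv hc => ?_
      · exact (stripEntry_coe _ p u v).symm.trans (h3 u v huv)
      · exact (stripEntry_coe _ q u v).symm.trans (h4 u v huv)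
      · refine (stripEntry_coe _ p u v).symm.trans ((h2 u v huv hc).trans ?_)
        rw [hu, hv]
        exact stripEntry_coe _ q u' v'
    have h6 := block_eq hRS hN p q
    refine hne ?_
    rw [eq_conjTranspose_mul (rowBlock_mem hRS p) h6, ← eq_conjTranspose_mul (rowBlock_mem hRS p) h5]

theorem Derived.finrank_lt {A' : MarkedBlockMatrix m n} (h : A.Derived A') :
    Module.finrank ℂ A'.shape.blockSpace < Module.finrank ℂ A.shape.blockSpace :=
  Submodule.finrank_lt_finrank_of_lt h.blockSpace_lt

theorem Derived.not_isFinal {A' : MarkedBlockMatrix m n} (h : A.Derived A') : ¬ A.IsFinal := by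
  obtain ⟨p, q, hpq, -⟩ := h
  exact fun hA => hA p q hpq.1

/-! ### The reduction process -/

theorem not_exists_infinite (A : MarkedBlockMatrix m n) :
    ¬ ∃ seq : ℕ → MarkedBlockMatrix m n, seq 0 = A ∧ ∀ i, (seq i).Derived (seq (i + 1)) := by
  rintro ⟨seq, -, h⟩
  exact not_strictAnti_of_wellFoundedLT (fun i => Module.finrank ℂ (seq i).shape.blockSpace)
    (strictAnti_nat_of_succ_lt fun i => (h i).finrank_lt)

theorem exists_final (A : MarkedBlockMatrix m n) :
    ∃ T, Relation.ReflTransGen Derived A T ∧ T.IsFinal := by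
  induction h : Module.finrank ℂ A.shape.blockSpace using Nat.strong_induction_on generalizing A with
  | _ d ih =>
    by_cases hA : A.IsFinal
    · exact ⟨A, .refl, hA⟩
    · obtain ⟨A', hA'⟩ := exists_derived hA
      obtain ⟨T, hT, hT'⟩ := ih _ (h ▸ hA'.finrank_lt) A' rfl
      exact ⟨T, .head hA' hT, hT'⟩

theorem equivalent_of_reduction {T : MarkedBlockMatrix m n}
    (h : Relation.ReflTransGen Derived A T) : A.Equivalent ⟨A.shape, T.mat⟩ := by
  induction h using Relation.ReflTransGen.head_induction_on with
  | refl => exact .refl _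
  | head h _ ih =>
    obtain ⟨p, q, -, h', -⟩ := id h
    exact h'.trans (ih.mono h.blockSpace_lt.le)

/-- Reductions of equivalent matrices go in parallel. -/
theorem equivalent_of_reductions {T T' : MarkedBlockMatrix m n}
    (h : Relation.ReflTransGen Derived A T) (hT : T.IsFinal) (hAB : A.Equivalent B)
    (h' : Relation.ReflTransGen Derived B T') (hT' : T'.IsFinal) : T.Equivalent T' := by
  induction h using Relation.ReflTransGen.head_induction_on generalizing B with
  | refl =>
    rcases h'.cases_head with rfl | ⟨B₁, hB₁, -⟩
    · exact hAB
    · exact absurd (hT.of_equivalent hAB) hB₁.not_isFinal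
  | head hA₁ _ ih =>
    rcases h'.cases_head with rfl | ⟨B₁, hB₁, hB₁'⟩
    · exact absurd (hT'.of_equivalent hAB.symm) hA₁.not_isFinal
    · exact ih (hA₁.equivalent hAB hB₁) hB₁'

theorem IsCanonicalForm.equivalent (h : A.IsCanonicalForm C) : A.Equivalent C := by
  obtain ⟨T, hT, -, rfl⟩ := h
  exact equivalent_of_reduction hT

theorem IsCanonicalForm.eq {A' B' : MarkedBlockMatrix m n} (hA : A.IsCanonicalForm A')
    (hB : B.IsCanonicalForm B') (h : A.Equivalent B) : A' = B' := by
  obtain ⟨T, hT, hTf, rfl⟩ := hA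
  obtain ⟨T', hT', hTf', rfl⟩ := hB
  rw [hTf.mat_eq (equivalent_of_reductions hT hTf h hT' hTf'), h.1]

end MarkedBlockMatrix

theorem theorem2p1p3 {m n : ℕ} :
    -- the reduction process always ends
    (∀ A : MarkedBlockMatrix m n,
      ¬ ∃ seq : ℕ → MarkedBlockMatrix m n, seq 0 = A ∧ ∀ i, (seq i).Derived (seq (i + 1))) ∧
    -- the canonical form exists and is unique
    (∀ A : MarkedBlockMatrix m n, ∃! C, A.IsCanonicalForm C) ∧
    -- each matrix is equivalent to its canonical form
    (∀ A C : MarkedBlockMatrix m n, A.IsCanonicalForm C → A.Equivalent C) ∧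
    -- two matrices are equivalent iff their canonical forms coincide
    (∀ A B A' B' : MarkedBlockMatrix m n, A.IsCanonicalForm A' → B.IsCanonicalForm B' →
      (A.Equivalent B ↔ A' = B')) := by
  refine ⟨fun A => A.not_exists_infinite, fun A => ?_, fun A C h => h.equivalent,
    fun A B A' B' hA hB => ⟨hA.eq hB, ?_⟩⟩
  · obtain ⟨T, hT, hTf⟩ := A.exists_final
    have h : A.IsCanonicalForm ⟨A.shape, T.mat⟩ := ⟨T, hT, hTf, rfl⟩
    exact ⟨_, h, fun C hC => hC.eq h (.refl A)⟩
  · rintro rfl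
    exact hA.equivalent.trans hB.equivalent.symm
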